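/- **Setting.** Let $1\le d\le n$. An error operator on $n$ qubits is a tensor product $E=\sigma_{a_1}\otimes\cdots\otimes\sigma_{a_n}$ of matrices from $\{I,\sigma_x,\sigma_y,\sigma_z\}$; its weight $\mathrm{wt}(E)$ is the number of factors different from $I$. An $((n,K,d))$ quantum code is a subspace $Q\subseteq(\mathbb C^2)^{\otimes n}$ of dimension $K\ge 1$, with orthogonal projection $P$, such that for every error operator $E$ of weight less than $d$ the operator $PEP$ is a scalar multiple of $P$. Put $$A_i=\frac1{K^2}\sum_{\mathrm{wt}(E)=i}\mathrm{Tr}(EP)\,\mathrm{Tr}(EP),\qquad B_i=\frac1K\sum_{\mathrm{wt}(E)=i}\mathrm{Tr}(EPEP).$$ The code is nondegenerate if $A_i=0$ for $i=1,\dots,d-1$. Let $P_t(x,n)=\sum_{j=0}^{t}(-1)^j3^{t-j}\binom{x}{j}\binom{n-x}{t-j}$ be the Krawtchouk polynomial (a polynomial in $x$). We say that a real polynomial $f(x)=\sum_{i=0}^n f_iP_i(x,n)$ is *admissible* for $(n,d)$ if $f_0>0$, $f_i\ge0$ for $1\le i\le n$, $f(0)>0$, and $f(i)\le 0$ for $d\le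 i\le n$. **Theorem.** Let $1\le d\le n$. 1. (Linear programming bound.) For every nondegenerate $((n,K,d))$ quantum code and every $f$ admissible for $(n,d)$, $$2^nK=\frac{f(0)+\sum_{i=1}^n f(i)B_i}{f_0+\sum_{i=1}^n f_iA_i}\le\frac{f(0)}{f_0}.$$ 2. (Quantum Singleton bound.) The polynomial $f(x)=4^{n-d+1}\prod_{j=d}^n\left(1-\frac xj\right)$ is admissible, with coefficients $f_i=\binom{n-i}{d-1}/\binom{n}{d-1}$, and every nondegenerate $((n,K,d))$ code satisfies $K\le 2^{n-2d+2}$. 3. (Quantum Hamming bound.) Let $d=2e+1$ and $V=\sum_{i=0}^e3^i\binom ni$. The polynomial with Krawtchouk coefficients $f_i=\left(P_e(i-1,n-1)/V\right)^2$, $0\le i\le n$, is admissible, with $f(i)=0$ for $d\le i\le n$ and $f(0)=4^n/V$, and every nondegenerate $((n,K,d))$ code satisfies $K\le 2^n/V$. 4. (Levenshtein-type bound.) Let $d_k(m)$ be the smallest root of $P_k(x,m)$ for $1\le k\le m$, and $d_0(m)=+\infty$. Put $$L_k^n(x)=\sum_{i=0}^{k-1}\binom ni3^i-\binom nk3^k\,\frac{P_{k-1}(x-1,n-1)}{P_k(x,n)},$$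 and let $$L^n(d)=\begin{cases}L_k^n(d)&\text{if } 1\le k\le n-1 \text{ and } d_k(n-1)+1<d<d_{k-1}(n-2)+1,\\ 4L_k^{n-1}(d)&\text{if } 1\le k\le n-2 \text{ and } d_k(n-2)+1<d<d_k(n-1)+1.\end{cases}$$ Whenever $d$ lies in one of these ranges, the denominator in the formula is nonzero at $d$, there is an admissible $f$ with $f(0)/f_0=L^n(d)$, and every nondegenerate $((n,K,d))$ code satisfies $K\le L^n(d)/2^n$. -/

import Mathlib

open scoped BigOperators

noncomputable section

namespace QuantumLP

/-- The Hilbert space of `n` qubits, `ℂ^(2^n)`, with computational basis `Fin n → Fin 2`. -/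
abbrev Qubits (n : ℕ) : Type := EuclideanSpace ℂ (Fin n → Fin 2)

/-- The identity and the three Pauli matrices. -/
def pauli : Fin 4 → Matrix (Fin 2) (Fin 2) ℂ :=
  ![1, !![0, 1; 1, 0], !![0, -Complex.I; Complex.I, 0], !![1, 0; 0, -1]]

/-- The error operator `σ_{a 0} ⊗ ⋯ ⊗ σ_{a (n-1)}` on `n` qubits. Its weight, the number of tensor
factors different from the identity, is `hammingNorm a`. -/
def errorOp {n : ℕ} (a : Fin n → Fin 4) : Module.End ℂ (Qubits n) :=
  Matrix.toEuclideanLin (Matrix.of fun x y : Fin n → Fin 2 => ∏ k, pauli (a k) (x k) (y k))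

/-- The orthogonal projection operator onto a code. -/
def proj {n : ℕ} (Q : Submodule ℂ (Qubits n)) : Module.End ℂ (Qubits n) :=
  (Q.starProjection : Qubits n →ₗ[ℂ] Qubits n)

/-- `A_i = K⁻² ∑_{wt E = i} Tr(EP) Tr(EP)`, where `K = dim Q`. -/
def enumA {n : ℕ} (Q : Submodule ℂ (Qubits n)) (i : ℕ) : ℂ :=
  (∑ a : Fin n → Fin 4 with hammingNorm a = i,
    LinearMap.trace ℂ (Qubits n) (errorOp a * proj Q) *
      LinearMap.trace ℂ (Qubits n) (errorOp a * proj Q)) / (Module.finrank ℂ Q : ℂ) ^ 2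

/-- `B_i = K⁻¹ ∑_{wt E = i} Tr(EPEP)`, where `K = dim Q`. -/
def enumB {n : ℕ} (Q : Submodule ℂ (Qubits n)) (i : ℕ) : ℂ :=
  (∑ a : Fin n → Fin 4 with hammingNorm a = i,
    LinearMap.trace ℂ (Qubits n) (errorOp a * proj Q * errorOp a * proj Q)) /
      (Module.finrank ℂ Q : ℂ)

/-- `Q` is an `((n,K,d))` quantum code: a nonzero subspace of dimension `K` that detects every
error of weight less than `d`, that is, `P E P` is a multiple of `P` for all such `E`. -/
structure IsQuantumCode (n K d : ℕ) (Q : Submodule ℂ (Qubits n)) : Prop where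
  pos : 0 < K
  finrank_eq : Module.finrank ℂ Q = K
  detects : ∀ a : Fin n → Fin 4, hammingNorm a < d →
    ∃ c : ℂ, proj Q * errorOp a * proj Q = c • proj Q

/-- `Q` is a nondegenerate `((n,K,d))` code: `A_i = 0` for `i = 1, …, d - 1`. -/
structure IsNondegenerateCode (n K d : ℕ) (Q : Submodule ℂ (Qubits n)) : Prop
    extends IsQuantumCode n K d Q where
  enumA_eq_zero : ∀ i : ℕ, 1 ≤ i → i < d → enumA Q i = 0

/-- The binomial coefficient `p (p - 1) ⋯ (p - j + 1) / j!` of a real polynomial `p`. -/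
def polyChoose (p : Polynomial ℝ) (j : ℕ) : Polynomial ℝ :=
  Polynomial.C ((j.factorial : ℝ)⁻¹) * (descPochhammer ℝ j).comp p

/-- The quaternary Krawtchouk polynomial
`P_t(x, n) = ∑_{j=0}^t (-1)^j 3^(t-j) (x choose j) (n-x choose t-j)`, as a polynomial in `x`. -/
def kraw (n t : ℕ) : Polynomial ℝ :=
  ∑ j ∈ Finset.range (t + 1), Polynomial.C ((-1 : ℝ) ^ j * 3 ^ (t - j)) *
    polyChoose Polynomial.X j *
    polyChoose (Polynomial.C (n : ℝ) - Polynomial.X) (t - j)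

/-- `f` has the Krawtchouk expansion `f(x) = ∑_{i=0}^n c_i P_i(x, n)`, and `f` and `c` satisfy the
conditions `c_0 > 0`, `c_i ≥ 0` for `1 ≤ i ≤ n`, `f(0) > 0`, `f(i) ≤ 0` for `d ≤ i ≤ n`. -/
structure LPConditions (n d : ℕ) (f : Polynomial ℝ) (c : ℕ → ℝ) : Prop where
  expansion : f = ∑ i ∈ Finset.range (n + 1), Polynomial.C (c i) * kraw n i
  coeff_zero_pos : 0 < c 0
  coeff_nonneg : ∀ i : ℕ, 1 ≤ i → i ≤ n → 0 ≤ c i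
  eval_zero_pos : 0 < f.eval 0
  eval_nonpos : ∀ i : ℕ, d ≤ i → i ≤ n → f.eval (i : ℝ) ≤ 0

/-- `4^(n-d+1) ∏_{j=d}^n (1 - x/j)`. -/
def singletonPoly (n d : ℕ) : Polynomial ℝ :=
  Polynomial.C ((4 : ℝ) ^ (n - d + 1)) *
    ∏ j ∈ Finset.Icc d n, (1 - Polynomial.C ((j : ℝ)⁻¹) * Polynomial.X)

/-- The size `∑_{i=0}^e 3^i (n choose i)` of a Hamming ball of radius `e`. -/
def ballSize (n e : ℕ) : ℝ := ∑ i ∈ Finset.range (e + 1), (3 : ℝ) ^ i * (n.choose i : ℝ)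

/-- `(P_e(i-1, n-1) / ∑_{i=0}^e 3^i (n choose i))^2`. -/
def hammingCoeff (n e i : ℕ) : ℝ :=
  (((kraw (n - 1) e).eval ((i : ℝ) - 1)) / ballSize n e) ^ 2

/-- The polynomial with Krawtchouk coefficients `hammingCoeff n e i`, `0 ≤ i ≤ n`. -/
def hammingPoly (n e : ℕ) : Polynomial ℝ :=
  ∑ i ∈ Finset.range (n + 1), Polynomial.C (hammingCoeff n e i) * kraw n i

/-- `d_k(m)`, the smallest root of `P_k(x, m)` (used only for `1 ≤ k ≤ m`). -/
def minRoot (k m : ℕ) : ℝ := sInf {x : ℝ | (kraw m k).IsRoot x}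

/-- `L_k^n(x) = ∑_{i=0}^{k-1} (n choose i) 3^i
  - (n choose k) 3^k P_{k-1}(x-1, n-1) / P_k(x, n)`. -/
def levenshtein (k n : ℕ) (x : ℝ) : ℝ :=
  (∑ i ∈ Finset.range k, (n.choose i : ℝ) * 3 ^ i) -
    (n.choose k : ℝ) * 3 ^ k * ((kraw (n - 1) (k - 1)).eval (x - 1) / (kraw n k).eval x)

end QuantumLP

end

/-!
Write `wt a` for the weight `hammingNorm a` and `χ(a, b) = ±1` (`errorSign`) for the sign with which
two error operators commute. Everything rests on `sum_errorSign_of_weight`: on integers,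
`P_t(wt b, n) = ∑_{wt a = t} χ(a, b)`, the coefficient of `z^t` in `(1 + 3z)^(n - l) (1 - z)^l` with
`l = wt b`. Orthogonality, the symmetry `w(l) P_t(l) = w(t) P_l(t)` for `w(l) = 3^l (n choose l)`,
the recurrences, and the fact that products of Krawtchouk polynomials have nonnegative Krawtchouk
coefficients (`KrawNonneg.mul`) all follow; identities between polynomials of degree at most `n` are
checked at `0, …, n`.

*Linear programming bound.* The Pauli completeness relation, tensored over the qubits, gives
`∑_a χ(a, b) Tr(E_a P)² = 2^n Tr(E_b P E_b P)`, hence the MacWilliams identity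
`∑_i P_j(i) B_i = 2^n K A_j` (`sum_kraw_mul_enumB`). Summing against the coefficients of `f` gives
`∑ f(i) B_i = 2^n K ∑ f_i A_i`; here `A_i, B_i ≥ 0`, `A_0 = B_0 = 1`, and `B_i = A_i = 0` for
`1 ≤ i < d`, so the sign conditions on `f` give the bound.

*Singleton and Hamming.* The Singleton expansion is an identity of polynomials of degree at most
`n - d + 1` which agree at `0, d, …, n`. The Hamming coefficients are the values of a polynomial of
degree `2e`, which is orthogonal to `P_l` for `l > 2e`; this makes `f(l)` vanish. They are also the
squares of `∑_{j ≤ e} P_j / V`, which gives `f(0)`.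

*Levenshtein.* With `φ_i(x) = P_i(x - 1, n - 1) = ∑_{j ≤ i} P_j(x, n)`, suppose `φ_i(d) > 0` for
`i < k` and `φ_k(d) < 0`. By the Christoffel–Darboux formula,
`F = k (φ_{k-1}(d) φ_k - φ_k(d) φ_{k-1})` equals `(d - x) T(x)`, where `T` is a positive combination
of `φ_0, …, φ_{k-1}`. So `F T = (d - x) T²` has the right signs at integers, and nonnegative
coefficients since both factors have them. As `F` is orthogonal to polynomials of degree at most
`k - 2` for the weight `x w(x)`, the constant coefficient of `F T` is `T(0)` times that of `F`, and
the ratio `f(0) / f_0 = F(0) / F_0` is `L_k^n(d)` (`exists_lpConditions_levenshtein`).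
Multiplication by `n - x` passes from length `n - 1` to length `n` at the cost of a factor `4`
(`LPConditions.succ_length`). That `d` satisfies the sign conditions in the stated ranges follows
from the recurrence, which orders the smallest roots, and from the Christoffel–Darboux formula with
one argument at the smallest root (`kraw_succ_eval_neg`).
-/

namespace QuantumLP

open Polynomial
open scoped ComplexOrder

/-! ### Krawtchouk polynomials and their generating function -/

lemma polyChoose_eval_natCast {p : ℝ[X]} {x : ℝ} {m : ℕ} (h : p.eval x = m) (j : ℕ) :
    (polyChoose p j).eval x = m.choose j := by
  rw [polyChoose, eval_mul, eval_C, eval_comp, h, descPochhammer_eval_eq_descFactorial,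
    Nat.descFactorial_eq_factorial_mul_choose]
  push_cast
  field_simp

lemma natDegree_polyChoose_le {p : ℝ[X]} (hp : p.natDegree ≤ 1) (j : ℕ) :
    (polyChoose p j).natDegree ≤ j := by
  refine (natDegree_C_mul_le _ _).trans (natDegree_comp_le.trans ?_)
  rw [descPochhammer_natDegree]
  exact (Nat.mul_le_mul_left j hp).trans_eq (mul_one j)

lemma natDegree_kraw_le (n t : ℕ) : (kraw n t).natDegree ≤ t := by
  refine natDegree_sum_le_of_forall_le _ _ fun j hj => ?_
  have h1 := natDegree_polyChoose_le (natDegree_X_le (R := ℝ)) j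
  have h2 := natDegree_polyChoose_le (p := C (n : ℝ) - X)
    ((natDegree_sub_le _ _).trans (by simp)) (t - j)
  have hj' : j ≤ t := Nat.lt_succ_iff.mp (Finset.mem_range.mp hj)
  refine natDegree_mul_le.trans ((Nat.add_le_add_right (natDegree_C_mul_le _ _) _).trans ?_)
  omega

lemma kraw_zero (n : ℕ) : kraw n 0 = 1 := by
  simp [kraw, polyChoose]

lemma kraw_eval_natCast (n t l : ℕ) (hl : l ≤ n) :
    (kraw n t).eval (l : ℝ) = ∑ j ∈ Finset.range (t + 1),
      (-1 : ℝ) ^ j * 3 ^ (t - j) * (l.choose j) * ((n - l).choose (t - j)) := by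
  rw [kraw, eval_finsetSum]
  refine Finset.sum_congr rfl fun j _ => ?_
  rw [eval_mul, eval_mul, eval_C, polyChoose_eval_natCast (m := l) (by simp),
    polyChoose_eval_natCast (m := n - l) (by simp [Nat.cast_sub hl])]

/-- The generating function `∑_t P_t(l, n) z^t` for an integer argument `0 ≤ l ≤ n`. -/
noncomputable def krawGen (n l : ℕ) : ℝ[X] := (1 + C 3 * X) ^ (n - l) * (1 - X) ^ l

lemma coeff_one_add_C_mul_X_pow (c : ℝ) (a i : ℕ) :
    ((1 + C c * X : ℝ[X]) ^ a).coeff i = a.choose i * c ^ i := by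
  have : (1 + C c * X : ℝ[X]) ^ a = ((1 + X) ^ a).comp (C c * X) := by simp
  rw [this, comp_C_mul_X_coeff, coeff_one_add_X_pow]

lemma coeff_krawGen (n t l : ℕ) (hl : l ≤ n) :
    (krawGen n l).coeff t = (kraw n t).eval (l : ℝ) := by
  have h : (1 - X : ℝ[X]) = 1 + C (-1) * X := by simp [sub_eq_add_neg]
  rw [kraw_eval_natCast n t l hl, krawGen, mul_comm, coeff_mul,
    Finset.Nat.sum_antidiagonal_eq_sum_range_succ
      (fun i j => ((1 - X : ℝ[X]) ^ l).coeff i * ((1 + C 3 * X : ℝ[X]) ^ (n - l)).coeff j)]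
  refine Finset.sum_congr rfl fun j _ => ?_
  rw [h, coeff_one_add_C_mul_X_pow, coeff_one_add_C_mul_X_pow]
  ring

lemma kraw_eval_zero (n t : ℕ) : (kraw n t).eval 0 = n.choose t * 3 ^ t := by
  have := coeff_krawGen n t 0 (Nat.zero_le n)
  rw [Nat.cast_zero] at this
  rw [← this, krawGen, pow_zero, mul_one, Nat.sub_zero, coeff_one_add_C_mul_X_pow]

lemma kraw_eval_zero_pos {n t : ℕ} (h : t ≤ n) : 0 < (kraw n t).eval 0 := by
  rw [kraw_eval_zero]
  have := Nat.choose_pos h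
  positivity

/-- Polynomials of degree at most `n` that agree at `0, 1, …, n` are equal. -/
lemma eq_of_eval_natCast_eq {n : ℕ} {p q : ℝ[X]} (hp : p.natDegree ≤ n) (hq : q.natDegree ≤ n)
    (h : ∀ l : ℕ, l ≤ n → p.eval (l : ℝ) = q.eval (l : ℝ)) : p = q := by
  refine eq_of_natDegree_lt_card_of_eval_eq' p q
    ((Finset.range (n + 1)).image (Nat.cast : ℕ → ℝ)) ?_ ?_
  · intro x hx
    obtain ⟨l, hl, rfl⟩ := Finset.mem_image.mp hx
    exact h l (Nat.lt_succ_iff.mp (Finset.mem_range.mp hl))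
  · rw [Finset.card_image_of_injective _ Nat.cast_injective, Finset.card_range]
    omega

lemma kraw_recurrence_natCast (m i l : ℕ) (hl : l ≤ m) :
    ((i : ℝ) + 2) * (kraw m (i + 2)).eval (l : ℝ) =
      (3 * m - 2 * ((i : ℝ) + 1) - 4 * l) * (kraw m (i + 1)).eval (l : ℝ)
        - 3 * (m - i) * (kraw m i).eval (l : ℝ) := by
  have hG : (1 + C 3 * X) * (1 - X) * derivative (krawGen m l) =
      (C (3 * ((m - l : ℕ) : ℝ)) * (1 - X) - C (l : ℝ) * (1 + C 3 * X)) * krawGen m l := by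
    have hp : ∀ (p : ℝ[X]) (a : ℕ),
        p * derivative (p ^ a) = C (a : ℝ) * p ^ a * derivative p := by
      intro p a
      cases a with
      | zero => simp
      | succ a => rw [derivative_pow]; simp [pow_succ]; ring
    have h1 := hp (1 + C 3 * X) (m - l)
    have h2 := hp (1 - X) l
    have d1 : derivative (1 + C 3 * X : ℝ[X]) = C 3 := by simp
    have d2 : derivative (1 - X : ℝ[X]) = -1 := by simp
    rw [d1] at h1
    rw [d2] at h2
    rw [krawGen, derivative_mul, C_mul]
    linear_combination (1 - X) * (1 - X) ^ l * h1 + (1 + C 3 * X) * (1 + C 3 * X) ^ (m - l) * h2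
  have hL : (1 + C 3 * X) * (1 - X) * derivative (krawGen m l) =
      derivative (krawGen m l) + C 2 * (derivative (krawGen m l) * X)
        - C 3 * (derivative (krawGen m l) * X * X) := by
    have : (C 3 : ℝ[X]) = C 2 + 1 := by rw [← C_1, ← C_add]; norm_num
    linear_combination (derivative (krawGen m l) * X) * this
  have hR : (C (3 * ((m - l : ℕ) : ℝ)) * (1 - X) - C (l : ℝ) * (1 + C 3 * X)) * krawGen m l =
      C (3 * ((m - l : ℕ) : ℝ) - l) * krawGen m l
        - C (3 * ((m - l : ℕ) : ℝ) + 3 * l) * (krawGen m l * X) := by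
    simp only [C_mul, C_add, C_sub]
    ring
  rw [hL, hR] at hG
  have := congrArg (fun p => coeff p (i + 1)) hG
  simp only [coeff_add, coeff_sub, coeff_C_mul, coeff_mul_X] at this
  have h3 : (derivative (krawGen m l) * X).coeff i = i * (kraw m i).eval (l : ℝ) := by
    cases i with
    | zero => simp
    | succ i => rw [coeff_mul_X, coeff_derivative, coeff_krawGen m _ l hl]; push_cast; ring
  rw [h3] at this
  simp only [coeff_derivative, coeff_krawGen m _ l hl, Nat.cast_sub hl] at this
  push_cast at this
  linear_combination this

lemma kraw_one_natCast (m l : ℕ) (hl : l ≤ m) :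
    (kraw m 1).eval (l : ℝ) = 3 * m - 4 * l := by
  rw [kraw_eval_natCast m 1 l hl]
  simp [Finset.sum_range_succ, Nat.cast_sub hl]
  ring

lemma kraw_one {m : ℕ} (hm : 1 ≤ m) : kraw m 1 = C (3 * (m : ℝ)) - C 4 * X := by
  refine eq_of_eval_natCast_eq (n := m) ((natDegree_kraw_le m 1).trans hm) ?_ fun l hl => ?_
  · refine (natDegree_sub_le _ _).trans ?_
    rw [natDegree_C]
    exact max_le (Nat.zero_le m) ((natDegree_C_mul_le _ _).trans (natDegree_X_le.trans hm))
  · rw [kraw_one_natCast m l hl]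
    simp

/-- The three-term recurrence, at every real argument. -/
lemma kraw_recurrence {m i : ℕ} (hi : i + 2 ≤ m) (x : ℝ) :
    ((i : ℝ) + 2) * (kraw m (i + 2)).eval x =
      (3 * m - 2 * ((i : ℝ) + 1) - 4 * x) * (kraw m (i + 1)).eval x
        - 3 * (m - i) * (kraw m i).eval x := by
  have h : C ((i : ℝ) + 2) * kraw m (i + 2) =
      (C (3 * (m : ℝ) - 2 * ((i : ℝ) + 1)) - C 4 * X) * kraw m (i + 1)
        - C (3 * ((m : ℝ) - i)) * kraw m i := by
    refine eq_of_eval_natCast_eq (n := m) ?_ ?_ fun l hl => ?_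
    · exact (natDegree_C_mul_le _ _).trans ((natDegree_kraw_le _ _).trans hi)
    · refine (natDegree_sub_le _ _).trans (max_le (natDegree_mul_le.trans ?_)
        ((natDegree_C_mul_le _ _).trans ((natDegree_kraw_le _ _).trans (by omega))))
      have h1 : (C (3 * (m : ℝ) - 2 * ((i : ℝ) + 1)) - C 4 * X : ℝ[X]).natDegree ≤ 1 :=
        (natDegree_sub_le _ _).trans (max_le ((natDegree_C _).le.trans zero_le_one)
          ((natDegree_C_mul_le _ _).trans natDegree_X_le))
      have := natDegree_kraw_le m (i + 1)
      omega
    · simpa using kraw_recurrence_natCast m i l hl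
  simpa using congrArg (eval x) h

/-- Increasing the length by one coordinate outside the support multiplies the generating function
by `1 + 3z`. -/
lemma kraw_succ_length_natCast {m l : ℕ} (i : ℕ) (hl : l ≤ m) :
    (kraw (m + 1) (i + 1)).eval (l : ℝ) =
      (kraw m (i + 1)).eval (l : ℝ) + 3 * (kraw m i).eval (l : ℝ) := by
  have hg : krawGen (m + 1) l = krawGen m l + C 3 * (krawGen m l * X) := by
    rw [krawGen, krawGen, Nat.succ_sub hl, pow_succ]
    ring
  rw [← coeff_krawGen _ _ _ (Nat.le_succ_of_le hl), hg]
  simp [coeff_mul_X, coeff_krawGen _ _ _ hl]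

lemma kraw_succ_length {m i : ℕ} (hi : i + 1 ≤ m) (x : ℝ) :
    (kraw (m + 1) (i + 1)).eval x = (kraw m (i + 1)).eval x + 3 * (kraw m i).eval x := by
  have h : kraw (m + 1) (i + 1) = kraw m (i + 1) + C 3 * kraw m i := by
    refine eq_of_eval_natCast_eq (n := m) ((natDegree_kraw_le _ _).trans hi) ?_ fun l hl => ?_
    · exact (natDegree_add_le _ _).trans (max_le ((natDegree_kraw_le _ _).trans hi)
        ((natDegree_C_mul_le _ _).trans ((natDegree_kraw_le _ _).trans (by omega))))
    · simpa using kraw_succ_length_natCast i hl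
  simpa using congrArg (eval x) h

/-- The factor `m + 1 - x` carries length `m` to length `m + 1`. -/
lemma length_sub_mul_kraw {m i : ℕ} (hi : i ≤ m) :
    C 4 * ((C ((m : ℝ) + 1) - X) * kraw m i) =
      C ((m : ℝ) + 1 - i) * kraw (m + 1) i + C ((i : ℝ) + 1) * kraw (m + 1) (i + 1) := by
  refine eq_of_eval_natCast_eq (n := m + 1) ?_ ?_ fun l hl => ?_
  · refine (natDegree_C_mul_le _ _).trans (natDegree_mul_le.trans ?_)
    have h1 : (C ((m : ℝ) + 1) - X : ℝ[X]).natDegree ≤ 1 :=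
      (natDegree_sub_le _ _).trans (max_le ((natDegree_C _).le.trans zero_le_one) natDegree_X_le)
    have := natDegree_kraw_le m i
    omega
  · exact (natDegree_add_le _ _).trans (max_le
      ((natDegree_C_mul_le _ _).trans ((natDegree_kraw_le _ _).trans (by omega)))
      ((natDegree_C_mul_le _ _).trans ((natDegree_kraw_le _ _).trans (by omega))))
  · simp only [eval_mul, eval_add, eval_sub, eval_C, eval_X]
    rcases Nat.lt_or_ge m l with h | h
    · obtain rfl : l = m + 1 := by omega
      have hv : ∀ t, (kraw (m + 1) t).eval ((m + 1 : ℕ) : ℝ) = (m + 1).choose t * (-1) ^ t := by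
        intro t
        have h1 : (1 - X : ℝ[X]) = 1 + C (-1) * X := by simp [sub_eq_add_neg]
        rw [← coeff_krawGen _ _ _ le_rfl, krawGen, Nat.sub_self, pow_zero, one_mul, h1,
          coeff_one_add_C_mul_X_pow]
      have hch : ((m + 1).choose (i + 1) : ℝ) * (i + 1) = (m + 1).choose i * (m + 1 - i) := by
        have := Nat.choose_succ_right_eq (m + 1) i
        have h2 : ((m : ℝ) + 1 - i) = ((m + 1 - i : ℕ) : ℝ) := by
          rw [Nat.cast_sub (by omega)]; push_cast; ring
        rw [h2]
        exact_mod_cast this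
      rw [hv, hv]
      push_cast
      linear_combination (-1 : ℝ) ^ i * hch
    · cases i with
      | zero =>
        rw [kraw_zero, kraw_zero, kraw_one_natCast _ _ hl]
        simp
        ring
      | succ i =>
        have h1 := kraw_succ_length_natCast i h
        have h2 := kraw_succ_length_natCast (i + 1) h
        have h3 := kraw_recurrence_natCast m i l h
        rw [h1, h2]
        push_cast
        linear_combination -h3

/-- Increasing the length by one coordinate inside the support multiplies the generating function
by `1 - z`; hence `P_i(x, m)` is the sum of `P_j(x + 1, m + 1)` over `j ≤ i`. -/
lemma sum_kraw_eq {m i : ℕ} (hi : i ≤ m) (x : ℝ) :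
    ∑ j ∈ Finset.range (i + 1), (kraw (m + 1) j).eval x = (kraw m i).eval (x - 1) := by
  have step : ∀ j, j + 1 ≤ m → (kraw (m + 1) (j + 1)).eval x =
      (kraw m (j + 1)).eval (x - 1) - (kraw m j).eval (x - 1) := by
    intro j hj
    have h : (kraw (m + 1) (j + 1)).comp (X + C 1) = kraw m (j + 1) - kraw m j := by
      refine eq_of_eval_natCast_eq (n := m) ?_ ?_ fun l hl => ?_
      · refine natDegree_comp_le.trans ?_
        rw [natDegree_X_add_C, mul_one]
        exact (natDegree_kraw_le _ _).trans hj
      · exact (natDegree_sub_le _ _).trans (max_le ((natDegree_kraw_le _ _).trans hj)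
          ((natDegree_kraw_le _ _).trans (by omega)))
      · have hg : krawGen (m + 1) (l + 1) = krawGen m l - krawGen m l * X := by
          rw [krawGen, krawGen, Nat.add_sub_add_right, pow_succ]
          ring
        have e : ((kraw (m + 1) (j + 1)).comp (X + C 1)).eval (l : ℝ)
            = (kraw (m + 1) (j + 1)).eval ((l + 1 : ℕ) : ℝ) := by
          rw [eval_comp]; simp
        rw [e, ← coeff_krawGen _ _ _ (Nat.succ_le_succ hl), hg]
        simp [coeff_mul_X, coeff_krawGen _ _ _ hl]
    have := congrArg (eval (x - 1)) h
    simpa [eval_comp] using this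
  induction i with
  | zero => simp [kraw_zero]
  | succ i ih => rw [Finset.sum_range_succ, ih (by omega), step i hi]; ring

/-! ### Commutation signs of error operators -/

/-- The sign `±1` with which two Pauli matrices commute. -/
def pauliSign (s t : Fin 4) : ℝ := if s = 0 ∨ t = 0 ∨ s = t then 1 else -1

/-- The sign `±1` with which the error operators `errorOp a` and `errorOp b` commute. -/
noncomputable def errorSign {n : ℕ} (a b : Fin n → Fin 4) : ℝ := ∏ k, pauliSign (a k) (b k)

lemma pauliSign_comm (s t : Fin 4) : pauliSign s t = pauliSign t s := by
  fin_cases s <;> fin_cases t <;> simp [pauliSign]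

lemma errorSign_comm {n : ℕ} (a b : Fin n → Fin 4) : errorSign a b = errorSign b a :=
  Finset.prod_congr rfl fun _ _ => pauliSign_comm _ _

lemma errorSign_zero_right {n : ℕ} (a : Fin n → Fin 4) : errorSign a 0 = 1 := by
  simp [errorSign, pauliSign]

lemma prod_ite_eq_zero {R : Type*} [CommRing R] {n : ℕ} (a : Fin n → Fin 4) (u v : R) :
    ∏ k, (if a k = 0 then u else v) = u ^ (n - hammingNorm a) * v ^ hammingNorm a := by
  have h := Finset.card_filter_add_card_filter_not
    (s := (Finset.univ : Finset (Fin n))) (fun k => a k = 0)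
  rw [Finset.card_univ, Fintype.card_fin] at h
  have h' : hammingNorm a = (Finset.univ.filter fun k => ¬ a k = 0).card := rfl
  rw [Finset.prod_ite, Finset.prod_const, Finset.prod_const, h']
  congr 2
  omega

lemma hammingNorm_le {n : ℕ} (a : Fin n → Fin 4) : hammingNorm a ≤ n := by
  simpa using hammingNorm_le_card_fintype (x := a)

lemma exists_hammingNorm_eq {n l : ℕ} (hl : l ≤ n) :
    ∃ a : Fin n → Fin 4, hammingNorm a = l := by
  obtain ⟨s, -, hs⟩ := Finset.exists_subset_card_eq
    (s := (Finset.univ : Finset (Fin n))) (n := l) (by simpa using hl)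
  refine ⟨fun k => if k ∈ s then 1 else 0, ?_⟩
  rw [← hs, hammingNorm]
  congr 1
  ext k
  simp

/-- The two-variable weight enumerator of the sign character of `b`. -/
lemma sum_weight_mul_errorSign {R : Type*} [CommRing R] [Algebra ℝ R] {n : ℕ} (b : Fin n → Fin 4)
    (u v : R) :
    ∑ a : Fin n → Fin 4, u ^ (n - hammingNorm a) * v ^ hammingNorm a
        * algebraMap ℝ R (errorSign a b) =
      (u + 3 * v) ^ (n - hammingNorm b) * (u - v) ^ hammingNorm b := by
  have h1 : ∀ a : Fin n → Fin 4, u ^ (n - hammingNorm a) * v ^ hammingNorm a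
        * algebraMap ℝ R (errorSign a b) =
      ∏ k, ((if a k = 0 then u else v) * algebraMap ℝ R (pauliSign (a k) (b k))) := by
    intro a
    rw [Finset.prod_mul_distrib, prod_ite_eq_zero, errorSign, map_prod]
  rw [Finset.sum_congr rfl fun a _ => h1 a, ← prod_ite_eq_zero b (u + 3 * v) (u - v),
    ← Fintype.prod_sum (fun k (s : Fin 4) =>
      (if s = 0 then u else v) * algebraMap ℝ R (pauliSign s (b k)))]
  refine Finset.prod_congr rfl fun k _ => ?_
  generalize b k = t
  fin_cases t <;> simp [Fin.sum_univ_four, pauliSign] <;> ring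

/-- Krawtchouk polynomials are the character sums over error operators of given weight. -/
lemma sum_errorSign_of_weight {n : ℕ} (t : ℕ) (b : Fin n → Fin 4) :
    ∑ a : Fin n → Fin 4 with hammingNorm a = t, errorSign a b =
      (kraw n t).eval (hammingNorm b : ℝ) := by
  have h := sum_weight_mul_errorSign (R := ℝ[X]) b 1 X
  have h3 : (3 : ℝ[X]) = C 3 := (map_ofNat C 3).symm
  rw [h3, ← krawGen] at h
  rw [← coeff_krawGen _ _ _ (hammingNorm_le b), ← h, finsetSum_coeff, Finset.sum_filter]
  refine Finset.sum_congr rfl fun a _ => ?_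
  rw [one_pow, one_mul, algebraMap_eq, coeff_mul_C, coeff_X_pow]
  simp [eq_comm]

lemma card_weight_eq {n : ℕ} (t : ℕ) :
    (((Finset.univ : Finset (Fin n → Fin 4)).filter fun a => hammingNorm a = t).card : ℝ) =
      n.choose t * 3 ^ t := by
  have h := sum_errorSign_of_weight t (0 : Fin n → Fin 4)
  simp only [errorSign_zero_right, hammingNorm_zero, Nat.cast_zero, kraw_eval_zero] at h
  simpa using h

/-- Sums over all error operators, arranged by weight. -/
lemma sum_eq_sum_weight {M : Type*} [AddCommMonoid M] {n : ℕ} (g : (Fin n → Fin 4) → M) :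
    ∑ a, g a = ∑ x ∈ Finset.range (n + 1), ∑ a : Fin n → Fin 4 with hammingNorm a = x, g a :=
  (Finset.sum_fiberwise_of_maps_to
    (fun a _ => Finset.mem_range.mpr (Nat.lt_succ_of_le (hammingNorm_le a))) g).symm

lemma sum_weight_fun_mul_errorSign {n : ℕ} (h : ℕ → ℝ) (c : Fin n → Fin 4) :
    ∑ a : Fin n → Fin 4, h (hammingNorm a) * errorSign a c =
      ∑ x ∈ Finset.range (n + 1), h x * (kraw n x).eval (hammingNorm c : ℝ) := by
  rw [sum_eq_sum_weight]
  refine Finset.sum_congr rfl fun x _ => ?_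
  rw [← sum_errorSign_of_weight, Finset.mul_sum]
  exact Finset.sum_congr rfl fun a ha => by rw [(Finset.mem_filter.mp ha).2]

lemma sum_errorSign_mul_errorSign {n : ℕ} (b c : Fin n → Fin 4) :
    ∑ a, errorSign a b * errorSign a c = if b = c then (4 : ℝ) ^ n else 0 := by
  have h : ∀ s t : Fin 4, ∑ x, pauliSign x s * pauliSign x t = if s = t then 4 else 0 := by
    intro s t
    fin_cases s <;> fin_cases t <;> simp [Fin.sum_univ_four, pauliSign] <;> norm_num
  simp only [errorSign, ← Finset.prod_mul_distrib]
  rw [← Fintype.prod_sum (fun k x => pauliSign x (b k) * pauliSign x (c k))]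
  simp only [h]
  split_ifs with hbc
  · simp [hbc]
  · obtain ⟨k, hk⟩ := Function.ne_iff.mp hbc
    exact Finset.prod_eq_zero (Finset.mem_univ k) (if_neg hk)

/-- The product of two sign characters is a sign character, so correlations of three of them are
nonnegative. -/
lemma sum_errorSign_mul_mul_nonneg {n : ℕ} (b c e : Fin n → Fin 4) :
    0 ≤ ∑ a, errorSign a b * errorSign a c * errorSign a e := by
  have h : ∀ s t r : Fin 4, 0 ≤ ∑ x, pauliSign x s * pauliSign x t * pauliSign x r := by
    intro s t r
    fin_cases s <;> fin_cases t <;> fin_cases r <;>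
      simp [Fin.sum_univ_four, pauliSign] <;> norm_num
  simp only [errorSign, ← Finset.prod_mul_distrib]
  rw [← Fintype.prod_sum (fun k x => pauliSign x (b k) * pauliSign x (c k) * pauliSign x (e k))]
  exact Finset.prod_nonneg fun k _ => h _ _ _

/-! ### Orthogonality of Krawtchouk polynomials -/

lemma kraw_orthogonality {n i j : ℕ} (hj : j ≤ n) :
    ∑ x ∈ Finset.range (n + 1), (kraw n i).eval (x : ℝ) * (kraw n x).eval (j : ℝ) =
      if i = j then (4 : ℝ) ^ n else 0 := by
  obtain ⟨c, rfl⟩ := exists_hammingNorm_eq hj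
  rw [← sum_weight_fun_mul_errorSign (fun x => (kraw n i).eval (x : ℝ)) c]
  have h : ∀ a : Fin n → Fin 4, (kraw n i).eval (hammingNorm a : ℝ) * errorSign a c =
      ∑ b : Fin n → Fin 4 with hammingNorm b = i, errorSign a b * errorSign a c := by
    intro a
    rw [← sum_errorSign_of_weight, Finset.sum_mul]
    exact Finset.sum_congr rfl fun b _ => by rw [errorSign_comm b a]
  rw [Finset.sum_congr rfl fun a _ => h a, Finset.sum_comm]
  simp only [sum_errorSign_mul_errorSign]
  rw [Finset.sum_ite_eq' _ c]
  simp [eq_comm]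

lemma kraw_symmetry (n t l : ℕ) :
    (n.choose l * 3 ^ l : ℝ) * (kraw n t).eval (l : ℝ) =
      (n.choose t * 3 ^ t : ℝ) * (kraw n l).eval (t : ℝ) := by
  have key : ∀ p q : ℕ, (n.choose p * 3 ^ p : ℝ) * (kraw n q).eval (p : ℝ) =
      ∑ b : Fin n → Fin 4 with hammingNorm b = p,
        ∑ a : Fin n → Fin 4 with hammingNorm a = q, errorSign a b := by
    intro p q
    rw [← card_weight_eq, ← nsmul_eq_mul, ← Finset.sum_const]
    exact Finset.sum_congr rfl fun b hb => by
      rw [sum_errorSign_of_weight, (Finset.mem_filter.mp hb).2]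
  rw [key, key, Finset.sum_comm]
  simp only [errorSign_comm]

/-- A polynomial of degree less than `j` is orthogonal to `P_j` for the weight
`l ↦ 3^l (n choose l)`. -/
lemma sum_weight_mul_kraw_eq_zero {n j : ℕ} {r : ℝ[X]} (hr : r.natDegree < j) :
    ∑ l ∈ Finset.range (n + 1),
      (n.choose l * 3 ^ l : ℝ) * r.eval (l : ℝ) * (kraw n j).eval (l : ℝ) = 0 := by
  -- Monomials: multiplication by `l` moves the index of `P_j` by at most one.
  have mono : ∀ i j : ℕ, i < j → ∑ l ∈ Finset.range (n + 1),
      (n.choose l * 3 ^ l : ℝ) * (l : ℝ) ^ i * (kraw n j).eval (l : ℝ) = 0 := by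
    intro i
    induction i with
    | zero =>
      intro j hj
      have h := kraw_orthogonality (i := j) (Nat.zero_le n)
      rw [if_neg (by omega)] at h
      rw [← h]
      refine Finset.sum_congr rfl fun l _ => ?_
      rw [Nat.cast_zero, kraw_eval_zero]
      ring
    | succ i ih =>
      intro j hj
      obtain ⟨j, rfl⟩ : ∃ j', j = j' + 1 := ⟨j - 1, by omega⟩
      have e : ∀ l ∈ Finset.range (n + 1),
          (n.choose l * 3 ^ l : ℝ) * (l : ℝ) ^ (i + 1) * (kraw n (j + 1)).eval (l : ℝ) =
          (1 / 4) * ((3 * n - 2 * ((j : ℝ) + 1)) *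
              ((n.choose l * 3 ^ l : ℝ) * (l : ℝ) ^ i * (kraw n (j + 1)).eval (l : ℝ))
            - ((j : ℝ) + 2) *
              ((n.choose l * 3 ^ l : ℝ) * (l : ℝ) ^ i * (kraw n (j + 2)).eval (l : ℝ))
            - 3 * (n - j) *
              ((n.choose l * 3 ^ l : ℝ) * (l : ℝ) ^ i * (kraw n j).eval (l : ℝ))) := by
        intro l hl
        have := kraw_recurrence_natCast n j l (Nat.lt_succ_iff.mp (Finset.mem_range.mp hl))
        linear_combination (1 / 4) * (n.choose l * 3 ^ l : ℝ) * (l : ℝ) ^ i * this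
      rw [Finset.sum_congr rfl e, ← Finset.mul_sum, Finset.sum_sub_distrib,
        Finset.sum_sub_distrib, ← Finset.mul_sum, ← Finset.mul_sum, ← Finset.mul_sum,
        ih _ (by omega), ih _ (by omega), ih _ (by omega)]
      ring
  have e : ∀ l ∈ Finset.range (n + 1),
      (n.choose l * 3 ^ l : ℝ) * r.eval (l : ℝ) * (kraw n j).eval (l : ℝ) =
      ∑ i ∈ Finset.range (r.natDegree + 1), r.coeff i *
        ((n.choose l * 3 ^ l : ℝ) * (l : ℝ) ^ i * (kraw n j).eval (l : ℝ)) := by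
    intro l _
    rw [eval_eq_sum_range, Finset.mul_sum, Finset.sum_mul]
    exact Finset.sum_congr rfl fun i _ => by ring
  rw [Finset.sum_congr rfl e, Finset.sum_comm]
  refine Finset.sum_eq_zero fun i hi => ?_
  rw [← Finset.mul_sum, mono i j (by have := Finset.mem_range.mp hi; omega), mul_zero]

lemma sum_weight_mul_kraw_mul_kraw {n j k : ℕ} (hj : j ≤ n) :
    ∑ l ∈ Finset.range (n + 1),
      (n.choose l * 3 ^ l : ℝ) * ((kraw n j).eval (l : ℝ) * (kraw n k).eval (l : ℝ)) =
      if k = j then (n.choose j * 3 ^ j : ℝ) * 4 ^ n else 0 := by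
  have h : ∀ l ∈ Finset.range (n + 1),
      (n.choose l * 3 ^ l : ℝ) * ((kraw n j).eval (l : ℝ) * (kraw n k).eval (l : ℝ)) =
      (n.choose j * 3 ^ j : ℝ) * ((kraw n k).eval (l : ℝ) * (kraw n l).eval (j : ℝ)) := by
    intro l _
    have := kraw_symmetry n j l
    linear_combination (kraw n k).eval (l : ℝ) * this
  rw [Finset.sum_congr rfl h, ← Finset.mul_sum, kraw_orthogonality hj]
  split_ifs <;> simp

/-! ### Functions with nonnegative Krawtchouk coefficients -/

/-- The `i`-th Krawtchouk coefficient of a function on `{0, …, n}`. -/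
noncomputable def krawCoeff (n : ℕ) (h : ℕ → ℝ) (i : ℕ) : ℝ :=
  (∑ x ∈ Finset.range (n + 1), h x * (kraw n x).eval (i : ℝ)) / 4 ^ n

lemma sum_krawCoeff_mul_kraw {n : ℕ} (h : ℕ → ℝ) {l : ℕ} (hl : l ≤ n) :
    ∑ i ∈ Finset.range (n + 1), krawCoeff n h i * (kraw n i).eval (l : ℝ) = h l := by
  have e : ∀ i ∈ Finset.range (n + 1), krawCoeff n h i * (kraw n i).eval (l : ℝ) =
      ∑ x ∈ Finset.range (n + 1),
        h x / 4 ^ n * ((kraw n x).eval (i : ℝ) * (kraw n i).eval (l : ℝ)) := by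
    intro i _
    rw [krawCoeff, Finset.sum_div, Finset.sum_mul]
    exact Finset.sum_congr rfl fun x _ => by ring
  rw [Finset.sum_congr rfl e, Finset.sum_comm]
  simp only [← Finset.mul_sum, kraw_orthogonality hl]
  simp [Nat.lt_succ_of_le hl]

lemma krawCoeff_zero (n : ℕ) (h : ℕ → ℝ) :
    krawCoeff n h 0 =
      (∑ x ∈ Finset.range (n + 1), (n.choose x * 3 ^ x : ℝ) * h x) / 4 ^ n := by
  rw [krawCoeff]
  congr 1
  refine Finset.sum_congr rfl fun x _ => ?_
  rw [Nat.cast_zero, kraw_eval_zero]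
  ring

/-- The cone of functions on `{0, …, n}` all of whose Krawtchouk coefficients are nonnegative. -/
def KrawNonneg (n : ℕ) (h : ℕ → ℝ) : Prop := ∀ i ≤ n, 0 ≤ krawCoeff n h i

lemma KrawNonneg.add {n : ℕ} {g h : ℕ → ℝ} (hg : KrawNonneg n g) (hh : KrawNonneg n h) :
    KrawNonneg n (fun x => g x + h x) := by
  intro i hi
  have := add_nonneg (hg i hi) (hh i hi)
  rw [krawCoeff, krawCoeff, ← add_div, ← Finset.sum_add_distrib] at this
  simpa only [krawCoeff, add_mul] using this

lemma KrawNonneg.const_mul {n : ℕ} {h : ℕ → ℝ} (hh : KrawNonneg n h) {c : ℝ} (hc : 0 ≤ c) :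
    KrawNonneg n (fun x => c * h x) := by
  intro i hi
  have := mul_nonneg hc (hh i hi)
  rw [krawCoeff, ← mul_div_assoc, Finset.mul_sum] at this
  simpa only [krawCoeff, mul_assoc] using this

lemma krawNonneg_zero (n : ℕ) : KrawNonneg n (fun _ => 0) := by
  intro i _
  simp [krawCoeff]

lemma KrawNonneg.sum {n : ℕ} {ι : Type*} (s : Finset ι) {h : ι → ℕ → ℝ}
    (hh : ∀ i ∈ s, KrawNonneg n (h i)) : KrawNonneg n (fun x => ∑ i ∈ s, h i x) := by
  classical
  induction s using Finset.induction_on with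
  | empty => simpa using krawNonneg_zero n
  | insert i s his ih =>
    simp only [Finset.sum_insert his]
    exact (hh i (Finset.mem_insert_self i s)).add
      (ih fun j hj => hh j (Finset.mem_insert_of_mem hj))

lemma krawNonneg_kraw (n t : ℕ) : KrawNonneg n (fun x => (kraw n t).eval (x : ℝ)) := by
  intro i hi
  rw [krawCoeff, kraw_orthogonality hi]
  split_ifs <;> positivity

lemma krawNonneg_kraw_mul_kraw (n s t : ℕ) :
    KrawNonneg n (fun x => (kraw n s).eval (x : ℝ) * (kraw n t).eval (x : ℝ)) := by
  intro i hi
  obtain ⟨c, rfl⟩ := exists_hammingNorm_eq hi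
  refine div_nonneg ?_ (by positivity)
  rw [← sum_weight_fun_mul_errorSign
    (fun x => (kraw n s).eval (x : ℝ) * (kraw n t).eval (x : ℝ)) c]
  have h : ∀ a : Fin n → Fin 4,
      (kraw n s).eval (hammingNorm a : ℝ) * (kraw n t).eval (hammingNorm a : ℝ) * errorSign a c =
      ∑ b : Fin n → Fin 4 with hammingNorm b = s, ∑ e : Fin n → Fin 4 with hammingNorm e = t,
        errorSign a b * errorSign a e * errorSign a c := by
    intro a
    rw [← sum_errorSign_of_weight, ← sum_errorSign_of_weight, Finset.sum_mul_sum, Finset.sum_mul]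
    refine Finset.sum_congr rfl fun b _ => ?_
    rw [Finset.sum_mul]
    exact Finset.sum_congr rfl fun e _ => by rw [errorSign_comm b a, errorSign_comm e a]
  rw [Finset.sum_congr rfl fun a _ => h a, Finset.sum_comm]
  refine Finset.sum_nonneg fun b _ => ?_
  rw [Finset.sum_comm]
  exact Finset.sum_nonneg fun e _ => sum_errorSign_mul_mul_nonneg b e c

/-- The cone is closed under products, because the product of two sign characters is one. -/
lemma KrawNonneg.mul {n : ℕ} {g h : ℕ → ℝ} (hg : KrawNonneg n g) (hh : KrawNonneg n h) :
    KrawNonneg n (fun x => g x * h x) := by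
  have e : ∀ x ≤ n, g x * h x = ∑ i ∈ Finset.range (n + 1), ∑ j ∈ Finset.range (n + 1),
      krawCoeff n g i * krawCoeff n h j *
        ((kraw n i).eval (x : ℝ) * (kraw n j).eval (x : ℝ)) := by
    intro x hx
    rw [← sum_krawCoeff_mul_kraw g hx, ← sum_krawCoeff_mul_kraw h hx, Finset.sum_mul_sum]
    exact Finset.sum_congr rfl fun i _ => Finset.sum_congr rfl fun j _ => by ring
  intro l hl
  have := KrawNonneg.sum (n := n) (Finset.range (n + 1)) (h := fun i x =>
      ∑ j ∈ Finset.range (n + 1), krawCoeff n g i * krawCoeff n h j *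
        ((kraw n i).eval (x : ℝ) * (kraw n j).eval (x : ℝ)))
    (fun i hi => KrawNonneg.sum _ fun j hj => (krawNonneg_kraw_mul_kraw n i j).const_mul
      (mul_nonneg (hg i (Nat.lt_succ_iff.mp (Finset.mem_range.mp hi)))
        (hh j (Nat.lt_succ_iff.mp (Finset.mem_range.mp hj))))) l hl
  rw [krawCoeff] at this ⊢
  rwa [Finset.sum_congr rfl fun x hx => by
    rw [e x (Nat.lt_succ_iff.mp (Finset.mem_range.mp hx))]]

/-! ### The quantum Singleton polynomial -/

lemma natDegree_singletonPoly_le {n d : ℕ} (hdn : d ≤ n) :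
    (singletonPoly n d).natDegree ≤ n - d + 1 := by
  refine (natDegree_C_mul_le _ _).trans ((natDegree_prod_le _ _).trans ?_)
  refine (Finset.sum_le_card_nsmul _ _ 1 fun j _ => ?_).trans ?_
  · refine (natDegree_sub_le _ _).trans (max_le (by simp) ?_)
    exact (natDegree_C_mul_le _ _).trans natDegree_X_le
  · rw [Nat.card_Icc, smul_eq_mul]
    omega

lemma singletonPoly_eval_natCast {n d i : ℕ} (hd : 1 ≤ d) (hdi : d ≤ i) (hin : i ≤ n) :
    (singletonPoly n d).eval (i : ℝ) = 0 := by
  rw [singletonPoly, eval_mul, eval_prod,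
    Finset.prod_eq_zero (Finset.mem_Icc.mpr ⟨hdi, hin⟩), mul_zero]
  have : (i : ℝ) ≠ 0 := by norm_cast; omega
  simp [this]

lemma singletonPoly_eval_zero (n d : ℕ) : (singletonPoly n d).eval 0 = 4 ^ (n - d + 1) := by
  simp [singletonPoly, eval_prod]

/-- Both sides are the coefficient of `t^m` in
`∑_i (1 + t)^(n - i) P_i(l) = (4 + t)^(n - l) t^l`. -/
lemma sum_choose_mul_kraw {n l : ℕ} (hl : l ≤ n) (m : ℕ) :
    ∑ i ∈ Finset.range (n + 1), ((n - i).choose m : ℝ) * (kraw n i).eval (l : ℝ) =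
      ((4 + X : ℝ[X]) ^ (n - l) * X ^ l).coeff m := by
  obtain ⟨c, rfl⟩ := exists_hammingNorm_eq hl
  have h := sum_weight_mul_errorSign (R := ℝ[X]) c (1 + X) 1
  have h4 : (1 + X + 3 * 1 : ℝ[X]) = 4 + X := by ring
  rw [h4, add_sub_cancel_left] at h
  rw [← sum_weight_fun_mul_errorSign (fun i => ((n - i).choose m : ℝ)) c, ← h, finsetSum_coeff]
  refine Finset.sum_congr rfl fun a _ => ?_
  rw [one_pow, mul_one, algebraMap_eq, coeff_mul_C, coeff_one_add_X_pow]

lemma singletonPoly_eq {n d : ℕ} (hd : 1 ≤ d) (hdn : d ≤ n) :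
    singletonPoly n d = ∑ i ∈ Finset.range (n + 1),
      C (((n - i).choose (d - 1) : ℝ) / (n.choose (d - 1) : ℝ)) * kraw n i := by
  have hC : (n.choose (d - 1) : ℝ) ≠ 0 := by
    exact_mod_cast (Nat.choose_pos (by omega : d - 1 ≤ n)).ne'
  have hev : ∀ l : ℕ, l ≤ n → (∑ i ∈ Finset.range (n + 1),
      C (((n - i).choose (d - 1) : ℝ) / (n.choose (d - 1) : ℝ)) * kraw n i).eval (l : ℝ) =
      ((4 + X : ℝ[X]) ^ (n - l) * X ^ l).coeff (d - 1) / n.choose (d - 1) := by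
    intro l hl
    rw [← sum_choose_mul_kraw hl, eval_finsetSum, Finset.sum_div]
    exact Finset.sum_congr rfl fun i _ => by rw [eval_mul, eval_C]; ring
  -- Both sides have degree at most `n - d + 1` and agree at `0, d, d + 1, …, n`.
  refine eq_of_natDegree_lt_card_of_eval_eq' _ _
    ((insert 0 (Finset.Icc d n)).image (Nat.cast : ℕ → ℝ)) ?_ ?_
  · intro x hx
    obtain ⟨l, hl, rfl⟩ := Finset.mem_image.mp hx
    rcases Finset.mem_insert.mp hl with rfl | hl
    · rw [hev 0 (Nat.zero_le n), Nat.cast_zero, singletonPoly_eval_zero]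
      have e4 : (4 + X : ℝ[X]) = X + C 4 := by rw [add_comm, map_ofNat]
      rw [pow_zero, mul_one, Nat.sub_zero, e4, coeff_X_add_C_pow, mul_div_cancel_right₀ _ hC]
      congr 1
      omega
    · obtain ⟨h1, h2⟩ := Finset.mem_Icc.mp hl
      rw [hev l h2, singletonPoly_eval_natCast hd h1 h2, coeff_mul_X_pow', if_neg (by omega),
        zero_div]
  · rw [Finset.card_image_of_injective _ Nat.cast_injective,
      Finset.card_insert_of_notMem (by simp; omega), Nat.card_Icc, max_lt_iff]
    constructor
    · have := natDegree_singletonPoly_le hdn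
      omega
    · refine (natDegree_sum_le_of_forall_le (n := n - d + 1) _ _ fun i hi => ?_).trans_lt
        (by omega)
      rcases le_or_gt i (n - d + 1) with h | h
      · exact (natDegree_C_mul_le _ _).trans ((natDegree_kraw_le _ _).trans h)
      · rw [Nat.choose_eq_zero_of_lt (by have := Finset.mem_range.mp hi; omega)]
        simp

lemma lpConditions_singletonPoly {n d : ℕ} (hd : 1 ≤ d) (hdn : d ≤ n) :
    LPConditions n d (singletonPoly n d)
      (fun i => ((n - i).choose (d - 1) : ℝ) / (n.choose (d - 1) : ℝ)) where
  expansion := singletonPoly_eq hd hdn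
  coeff_zero_pos := by
    have : 0 < n.choose (d - 1) := Nat.choose_pos (by omega)
    simp only [Nat.sub_zero]
    positivity
  coeff_nonneg i _ _ := by positivity
  eval_zero_pos := by rw [singletonPoly_eval_zero]; positivity
  eval_nonpos i h1 h2 := (singletonPoly_eval_natCast hd h1 h2).le

/-! ### The quantum Hamming polynomial -/

lemma ballSize_pos (n e : ℕ) : 0 < ballSize n e := by
  rw [ballSize, Finset.sum_range_succ']
  have : 0 ≤ ∑ i ∈ Finset.range e, (3 : ℝ) ^ (i + 1) * (n.choose (i + 1) : ℝ) :=
    Finset.sum_nonneg fun i _ => by positivity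
  simp
  linarith

lemma kraw_pred_eval {n e : ℕ} (h : e + 1 ≤ n) (x : ℝ) :
    (kraw (n - 1) e).eval (x - 1) = ∑ j ∈ Finset.range (e + 1), (kraw n j).eval x := by
  obtain ⟨m, rfl⟩ : ∃ m, n = m + 1 := ⟨n - 1, by omega⟩
  rw [Nat.add_sub_cancel, sum_kraw_eq (by omega)]

lemma kraw_pred_eval_neg_one {n e : ℕ} (h : e + 1 ≤ n) :
    (kraw (n - 1) e).eval (0 - 1) = ballSize n e := by
  rw [kraw_pred_eval h, ballSize]
  exact Finset.sum_congr rfl fun j _ => by rw [kraw_eval_zero, mul_comm]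

lemma hammingCoeff_zero {n e : ℕ} (h : e + 1 ≤ n) : hammingCoeff n e 0 = 1 := by
  rw [hammingCoeff, Nat.cast_zero, kraw_pred_eval_neg_one h, div_self (ballSize_pos n e).ne',
    one_pow]

lemma hammingPoly_eval (n e : ℕ) (x : ℝ) : (hammingPoly n e).eval x =
    ∑ i ∈ Finset.range (n + 1), hammingCoeff n e i * (kraw n i).eval x := by
  simp [hammingPoly, eval_finsetSum]

/-- The coefficients of the Hamming polynomial are values of a polynomial of degree `2e`, which is
orthogonal to `P_l` for `l > 2e`. -/
lemma hammingPoly_eval_eq_zero {n e l : ℕ} (h1 : 2 * e + 1 ≤ l) (h2 : l ≤ n) :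
    (hammingPoly n e).eval (l : ℝ) = 0 := by
  set r : ℝ[X] := (C (ballSize n e)⁻¹ * (kraw (n - 1) e).comp (X - C 1)) ^ 2 with hr
  have hdeg : r.natDegree < l := by
    have h3 : ((kraw (n - 1) e).comp (X - C 1)).natDegree ≤ e := by
      refine natDegree_comp_le.trans ?_
      rw [natDegree_X_sub_C, mul_one]
      exact natDegree_kraw_le _ _
    have h4 := (natDegree_C_mul_le (ballSize n e)⁻¹ ((kraw (n - 1) e).comp (X - C 1))).trans h3
    have h5 := natDegree_pow_le (p := C (ballSize n e)⁻¹ * (kraw (n - 1) e).comp (X - C 1)) (n := 2)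
    rw [← hr] at h5
    omega
  have hre : ∀ i : ℕ, r.eval (i : ℝ) = hammingCoeff n e i := by
    intro i
    rw [hr, hammingCoeff, eval_pow, eval_mul, eval_C, eval_comp, div_eq_inv_mul]
    simp
  have hw : (n.choose l * 3 ^ l : ℝ) ≠ 0 := by
    have := Nat.choose_pos h2
    positivity
  have key := sum_weight_mul_kraw_eq_zero (n := n) hdeg
  rw [hammingPoly_eval, ← mul_right_inj' hw, mul_zero, ← key, Finset.mul_sum]
  refine Finset.sum_congr rfl fun i _ => ?_
  rw [hre]
  linear_combination hammingCoeff n e i * kraw_symmetry n i l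

lemma hammingPoly_eval_zero {n e : ℕ} (h : e + 1 ≤ n) :
    (hammingPoly n e).eval 0 = 4 ^ n / ballSize n e := by
  have hV := (ballSize_pos n e).ne'
  have e1 : ∀ i ∈ Finset.range (n + 1), hammingCoeff n e i * (kraw n i).eval 0 =
      (1 / ballSize n e ^ 2) * ∑ j ∈ Finset.range (e + 1), ∑ k ∈ Finset.range (e + 1),
        (n.choose i * 3 ^ i : ℝ) * ((kraw n j).eval (i : ℝ) * (kraw n k).eval (i : ℝ)) := by
    intro i _
    simp only [← Finset.mul_sum]
    rw [← Finset.sum_mul, ← kraw_pred_eval h, hammingCoeff, kraw_eval_zero]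
    field_simp
  have e2 : ∑ i ∈ Finset.range (n + 1), ∑ j ∈ Finset.range (e + 1), ∑ k ∈ Finset.range (e + 1),
        (n.choose i * 3 ^ i : ℝ) * ((kraw n j).eval (i : ℝ) * (kraw n k).eval (i : ℝ)) =
      ballSize n e * 4 ^ n := by
    rw [Finset.sum_comm, ballSize, Finset.sum_mul]
    refine Finset.sum_congr rfl fun j hj => ?_
    have hj' : j ≤ n := by have := Finset.mem_range.mp hj; omega
    rw [Finset.sum_comm, Finset.sum_congr rfl fun k _ => sum_weight_mul_kraw_mul_kraw hj',
      Finset.sum_ite_eq' _ j, if_pos hj]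
    ring
  rw [hammingPoly_eval, Finset.sum_congr rfl e1, ← Finset.mul_sum, e2]
  field_simp

lemma lpConditions_hammingPoly {n e : ℕ} (h : 2 * e + 1 ≤ n) :
    LPConditions n (2 * e + 1) (hammingPoly n e) (hammingCoeff n e) where
  expansion := rfl
  coeff_zero_pos := by rw [hammingCoeff_zero (by omega)]; exact one_pos
  coeff_nonneg i _ _ := sq_nonneg _
  eval_zero_pos := by
    rw [hammingPoly_eval_zero (by omega)]
    have := ballSize_pos n e
    positivity
  eval_nonpos i h1 h2 := (hammingPoly_eval_eq_zero h1 h2).le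

/-! ### The Christoffel–Darboux formula and the smallest roots -/

/-- The kernel coefficients are normalized by the squared norms `3^i (m choose i)`. -/
lemma christoffel_darboux {m k : ℕ} (hk : k + 1 ≤ m) (x y : ℝ) :
    ((k : ℝ) + 1) * ((kraw m (k + 1)).eval x * (kraw m k).eval y
        - (kraw m k).eval x * (kraw m (k + 1)).eval y) =
      (y - x) * ∑ i ∈ Finset.range (k + 1), 4 * (m.choose k * 3 ^ k / (m.choose i * 3 ^ i)) *
        (kraw m i).eval y * (kraw m i).eval x := by
  induction k with
  | zero =>
    simp [kraw_zero, kraw_one hk]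
    ring
  | succ k ih =>
    have hch : (m.choose (k + 1) : ℝ) * (k + 1) = m.choose k * (m - k) := by
      have := Nat.choose_succ_right_eq m k
      rw [← Nat.cast_sub (by omega : k ≤ m)]
      exact_mod_cast this
    have hpos : (m.choose (k + 1) * 3 ^ (k + 1) : ℝ) ≠ 0 := by
      have := Nat.choose_pos (by omega : k + 1 ≤ m)
      positivity
    have hsum : ((k : ℝ) + 1) * ∑ i ∈ Finset.range (k + 1),
          4 * (m.choose (k + 1) * 3 ^ (k + 1) / (m.choose i * 3 ^ i)) *
            (kraw m i).eval y * (kraw m i).eval x =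
        3 * ((m : ℝ) - k) * ∑ i ∈ Finset.range (k + 1),
          4 * (m.choose k * 3 ^ k / (m.choose i * 3 ^ i)) *
            (kraw m i).eval y * (kraw m i).eval x := by
      rw [Finset.mul_sum, Finset.mul_sum]
      refine Finset.sum_congr rfl fun i _ => ?_
      linear_combination (12 * 3 ^ k / (m.choose i * 3 ^ i) *
        (kraw m i).eval y * (kraw m i).eval x) * hch
    have hx := kraw_recurrence hk x
    have hy := kraw_recurrence hk y
    rw [Finset.sum_range_succ, div_self hpos]
    have hk1 : ((k : ℝ) + 1) ≠ 0 := by positivity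
    refine mul_left_cancel₀ hk1 ?_
    push_cast
    linear_combination ((k : ℝ) + 1) * (kraw m (k + 1)).eval y * hx
      - ((k : ℝ) + 1) * (kraw m (k + 1)).eval x * hy + 3 * ((m : ℝ) - k) * ih (by omega)
      - (y - x) * hsum

/-- All terms of the defining sum are nonnegative at `x ≤ 0`, so there are no roots there. -/
lemma kraw_eval_pos_of_nonpos {m k : ℕ} (hk : k ≤ m) {x : ℝ} (hx : x ≤ 0) :
    0 < (kraw m k).eval x := by
  have hneg : ∀ j : ℕ, 0 ≤ (-1 : ℝ) ^ j * (polyChoose X j).eval x := by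
    intro j
    have h : (-1 : ℝ) ^ j * (descPochhammer ℝ j).eval x = ∏ i ∈ Finset.range j, ((i : ℝ) - x) := by
      rw [descPochhammer_eval_eq_prod_range, ← Finset.card_range j, ← Finset.prod_const,
        Finset.card_range, ← Finset.prod_mul_distrib]
      exact Finset.prod_congr rfl fun i _ => by ring
    rw [polyChoose, comp_X, eval_mul, eval_C, mul_left_comm, h]
    refine mul_nonneg (by positivity) (Finset.prod_nonneg fun i _ => ?_)
    have : (0 : ℝ) ≤ i := i.cast_nonneg
    linarith
  have hpos : ∀ j : ℕ, j ≤ k → 0 < (polyChoose (C (m : ℝ) - X) j).eval x := by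
    intro j hj
    rw [polyChoose, eval_mul, eval_C, eval_comp]
    refine mul_pos (by positivity) (descPochhammer_pos ?_)
    have : (j : ℝ) ≤ m := by exact_mod_cast hj.trans hk
    simp
    linarith
  rw [kraw, eval_finsetSum]
  refine Finset.sum_pos' (fun j _ => ?_) ⟨0, by simp, ?_⟩
  · rw [eval_mul, eval_mul, eval_C, mul_right_comm _ ((3 : ℝ) ^ _), mul_right_comm]
    have := hneg j
    have := hpos (k - j) (by omega)
    positivity
  · have := hpos k le_rfl
    simp [polyChoose] at this ⊢
    exact this

lemma kraw_ne_zero {m k : ℕ} (hk : k ≤ m) : kraw m k ≠ 0 := by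
  intro h
  have := kraw_eval_pos_of_nonpos hk le_rfl
  simp [h] at this

lemma minRoot_le {m k : ℕ} (hk : k ≤ m) {x : ℝ} (hx : (kraw m k).eval x = 0) :
    minRoot k m ≤ x :=
  csInf_le (finite_setOfPred_isRoot (kraw_ne_zero hk)).bddBelow hx

lemma kraw_eval_minRoot {m k : ℕ} (hk : k ≤ m) (h : ∃ x, (kraw m k).eval x = 0) :
    (kraw m k).eval (minRoot k m) = 0 :=
  Set.Nonempty.csInf_mem (s := {x | (kraw m k).IsRoot x}) h
    (finite_setOfPred_isRoot (kraw_ne_zero hk))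

lemma exists_root_of_eval_nonpos {m k : ℕ} (hk : k ≤ m) {x : ℝ} (hx : (kraw m k).eval x ≤ 0) :
    ∃ z ≤ x, (kraw m k).eval z = 0 := by
  have hx0 : 0 ≤ x := by
    by_contra h
    exact absurd (kraw_eval_pos_of_nonpos hk (not_le.mp h).le) (not_lt.mpr hx)
  obtain ⟨z, hz, hz0⟩ := intermediate_value_Icc' hx0 (kraw m k).continuous.continuousOn
    ⟨hx, (kraw_eval_zero_pos hk).le⟩
  exact ⟨z, hz.2, hz0⟩

lemma kraw_eval_pos_of_lt_minRoot {m k : ℕ} (hk : k ≤ m) {x : ℝ} (hx : x < minRoot k m) :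
    0 < (kraw m k).eval x := by
  by_contra h
  obtain ⟨z, hz, hz0⟩ := exists_root_of_eval_nonpos hk (not_lt.mp h)
  exact absurd (minRoot_le hk hz0) (by linarith)

lemma minRoot_lt_of_eval_neg {m k : ℕ} (hk : k ≤ m) {x : ℝ} (hx : (kraw m k).eval x < 0) :
    minRoot k m < x := by
  obtain ⟨z, hz, hz0⟩ := exists_root_of_eval_nonpos hk hx.le
  refine (minRoot_le hk hz0).trans_lt (lt_of_le_of_ne hz ?_)
  rintro rfl
  exact hx.ne hz0

/-- At a zero of `P_{k+1}`, the recurrence gives `P_k` and `P_{k+2}` opposite signs. -/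
lemma kraw_add_two_eval_neg {m k : ℕ} (hk : k + 2 ≤ m) {x : ℝ}
    (h1 : (kraw m (k + 1)).eval x = 0) (h0 : 0 < (kraw m k).eval x) :
    (kraw m (k + 2)).eval x < 0 := by
  have h := kraw_recurrence hk x
  rw [h1, mul_zero, zero_sub] at h
  have hkm : (k : ℝ) + 2 ≤ m := by exact_mod_cast hk
  have hpos : 0 < 3 * ((m : ℝ) - k) * (kraw m k).eval x := by
    refine mul_pos ?_ h0
    linarith
  by_contra hc
  have := mul_nonneg (by positivity : (0 : ℝ) ≤ (k : ℝ) + 2) (not_lt.mp hc)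
  linarith

/-- The smallest roots exist, and they decrease with the index: all `P_i`, `i ≤ k`, are positive up
to and including the smallest root of `P_{k+1}`. -/
lemma exists_root_and_pos_of_le_minRoot {m k : ℕ} (hk : k + 1 ≤ m) :
    (∃ x, (kraw m (k + 1)).eval x = 0) ∧
      ∀ x ≤ minRoot (k + 1) m, ∀ i ≤ k, 0 < (kraw m i).eval x := by
  induction k with
  | zero =>
    refine ⟨⟨3 * m / 4, by rw [kraw_one hk]; simp; ring⟩, fun x _ i hi => ?_⟩
    rw [Nat.le_zero.mp hi, kraw_zero]
    simp
  | succ k ih =>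
    obtain ⟨hroot, hpos⟩ := ih (by omega)
    have hneg := kraw_add_two_eval_neg hk (kraw_eval_minRoot (by omega) hroot)
      (hpos _ le_rfl k le_rfl)
    have hlt := minRoot_lt_of_eval_neg hk hneg
    obtain ⟨z, -, hz⟩ := exists_root_of_eval_nonpos hk hneg.le
    refine ⟨⟨z, hz⟩, fun x hx i hi => ?_⟩
    rcases Nat.lt_or_ge k i with h | h
    · obtain rfl : i = k + 1 := by omega
      exact kraw_eval_pos_of_lt_minRoot (by omega) (hx.trans_lt hlt)
    · exact hpos x (hx.trans hlt.le) i h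

lemma kraw_eval_pos_of_lt_minRoot_of_le {m k i : ℕ} (hk : k + 1 ≤ m) (hi : i ≤ k + 1) {x : ℝ}
    (hx : x < minRoot (k + 1) m) : 0 < (kraw m i).eval x := by
  rcases Nat.lt_or_ge k i with h | h
  · obtain rfl : i = k + 1 := by omega
    exact kraw_eval_pos_of_lt_minRoot hk hx
  · exact (exists_root_and_pos_of_le_minRoot hk).2 x hx.le i h

/-- Beyond the smallest root of `P_{k+1}`, as long as all lower `P_i` are still positive, `P_{k+1}`
is negative: the Christoffel–Darboux kernel of this point and the smallest root is positive. -/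
lemma kraw_succ_eval_neg {m k : ℕ} (hk : k + 1 ≤ m) {y : ℝ} (hy : minRoot (k + 1) m < y)
    (hpos : ∀ i ≤ k, 0 < (kraw m i).eval y) : (kraw m (k + 1)).eval y < 0 := by
  obtain ⟨hroot, hr⟩ := exists_root_and_pos_of_le_minRoot hk
  have hcd := christoffel_darboux hk (minRoot (k + 1) m) y
  rw [kraw_eval_minRoot hk hroot, zero_mul, zero_sub] at hcd
  have hsum : 0 < (y - minRoot (k + 1) m) * ∑ i ∈ Finset.range (k + 1),
      4 * (m.choose k * 3 ^ k / (m.choose i * 3 ^ i)) *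
        (kraw m i).eval y * (kraw m i).eval (minRoot (k + 1) m) := by
    refine mul_pos (sub_pos.mpr hy) (Finset.sum_pos (fun i hi => ?_) (by simp))
    have hi' : i ≤ k := Nat.lt_succ_iff.mp (Finset.mem_range.mp hi)
    have h1 := hpos i hi'
    have h2 := hr _ le_rfl i hi'
    have h3 := Nat.choose_pos (by omega : i ≤ m)
    have h4 := Nat.choose_pos (by omega : k ≤ m)
    positivity
  rw [← hcd] at hsum
  by_contra hc
  have := mul_nonneg (hr _ le_rfl k le_rfl).le (not_lt.mp hc)
  have := mul_nonneg (by positivity : (0 : ℝ) ≤ (k : ℝ) + 1) this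
  linarith

/-- Positivity persists when the length grows from `m - 1` to `m`, by `kraw_succ_length`. -/
lemma kraw_eval_pos_of_range_left {m k : ℕ} (hk : k + 1 ≤ m) {y : ℝ}
    (hy : k = 0 ∨ y < minRoot k (m - 1)) : ∀ i ≤ k, 0 < (kraw m i).eval y := by
  intro i hi
  rcases i with _ | i
  · simp [kraw_zero]
  obtain ⟨m, rfl⟩ : ∃ m', m = m' + 1 := ⟨m - 1, by omega⟩
  obtain ⟨k, rfl⟩ : ∃ k', k = k' + 1 := ⟨k - 1, by omega⟩
  have hy' : y < minRoot (k + 1) m := hy.resolve_left (by omega)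
  have h1 := kraw_eval_pos_of_lt_minRoot_of_le (i := i + 1) (by omega) hi hy'
  have h2 := kraw_eval_pos_of_lt_minRoot_of_le (i := i) (by omega) (by omega) hy'
  rw [kraw_succ_length (by omega)]
  positivity

/-- The smallest root of `P_{k+1}(x, m + 1)` is below that of `P_k(x, m)`, where the former
polynomial takes the same value as `P_{k+1}(x, m)`, which is negative. -/
lemma kraw_eval_pos_of_range_right {m k : ℕ} (hk : k + 1 ≤ m) {y : ℝ}
    (hy : y < minRoot (k + 1) (m + 1)) : ∀ i ≤ k, 0 < (kraw m i).eval y := by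
  rcases k with _ | k
  · intro i hi
    rw [Nat.le_zero.mp hi, kraw_zero]
    simp
  obtain ⟨hroot, hpos⟩ := exists_root_and_pos_of_le_minRoot (by omega : k + 1 ≤ m)
  have h0 := kraw_eval_minRoot (by omega) hroot
  have hneg := kraw_add_two_eval_neg hk h0 (hpos _ le_rfl k le_rfl)
  have hneg' : (kraw (m + 1) (k + 2)).eval (minRoot (k + 1) m) < 0 := by
    rw [kraw_succ_length hk, h0]
    linarith
  have hlt := minRoot_lt_of_eval_neg (by omega) hneg'
  exact fun i hi => kraw_eval_pos_of_lt_minRoot_of_le (by omega) hi (hy.trans hlt)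

/-! ### The Levenshtein polynomials -/

lemma sum_weight_mul_kraw (n j : ℕ) :
    ∑ x ∈ Finset.range (n + 1), (n.choose x * 3 ^ x : ℝ) * (kraw n j).eval (x : ℝ) =
      if j = 0 then (4 : ℝ) ^ n else 0 := by
  have := sum_weight_mul_kraw_mul_kraw (k := j) (Nat.zero_le n)
  simpa [kraw_zero] using this

lemma sum_weight_mul_kraw_pred {m j : ℕ} (hj : j ≤ m) :
    ∑ x ∈ Finset.range (m + 1 + 1),
      ((m + 1).choose x * 3 ^ x : ℝ) * (kraw m j).eval ((x : ℝ) - 1) = 4 ^ (m + 1) := by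
  have e : ∀ x ∈ Finset.range (m + 1 + 1),
      ((m + 1).choose x * 3 ^ x : ℝ) * (kraw m j).eval ((x : ℝ) - 1) =
      ∑ i ∈ Finset.range (j + 1),
        ((m + 1).choose x * 3 ^ x : ℝ) * (kraw (m + 1) i).eval (x : ℝ) := by
    intro x _
    rw [← sum_kraw_eq hj, Finset.mul_sum]
  rw [Finset.sum_congr rfl e, Finset.sum_comm]
  simp only [sum_weight_mul_kraw]
  simp

/-- The polynomials `P_j(x - 1, m)` are orthogonal for the weight `x ↦ x 3^x (m + 1 choose x)`. -/
lemma sum_weight_mul_self_mul_kraw_pred {m j : ℕ} {r : ℝ[X]} (hr : r = 0 ∨ r.natDegree < j) :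
    ∑ x ∈ Finset.range (m + 1 + 1), ((m + 1).choose x * 3 ^ x : ℝ) *
      ((x : ℝ) * r.eval (x : ℝ) * (kraw m j).eval ((x : ℝ) - 1)) = 0 := by
  rcases hr with rfl | hr
  · simp
  have hr' : (r.comp (X + C 1)).natDegree < j := by
    refine natDegree_comp_le.trans_lt ?_
    rwa [natDegree_X_add_C, mul_one]
  have h := sum_weight_mul_kraw_eq_zero (n := m) hr'
  rw [Finset.sum_range_succ', Nat.cast_zero, zero_mul, zero_mul, mul_zero, add_zero]
  rw [← mul_zero (3 * ((m : ℝ) + 1)), ← h, Finset.mul_sum]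
  refine Finset.sum_congr rfl fun y _ => ?_
  have hch : ((m : ℝ) + 1) * m.choose y = (m + 1).choose (y + 1) * (y + 1) := by
    exact_mod_cast Nat.add_one_mul_choose_eq m y
  rw [eval_comp]
  simp only [eval_add, eval_X, eval_C]
  push_cast
  rw [add_sub_cancel_right]
  linear_combination (-3 * 3 ^ y * r.eval ((y : ℝ) + 1) * (kraw m j).eval (y : ℝ)) * hch

lemma krawNonneg_kraw_pred {m j : ℕ} (hj : j ≤ m) :
    KrawNonneg (m + 1) (fun x => (kraw m j).eval ((x : ℝ) - 1)) := by
  have := KrawNonneg.sum (Finset.range (j + 1)) fun i _ => krawNonneg_kraw (m + 1) i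
  simpa only [sum_kraw_eq hj] using this

/-- The admissible polynomial is `(d - x) T(x)²` at the integers `0, …, n`, with `T` the
Christoffel–Darboux kernel of the polynomials `P_i(x - 1, n - 1)`, `i < k`, at `d`. -/
lemma exists_lpConditions_levenshtein {m k d : ℕ} (hk : k + 1 ≤ m) (hd : 1 ≤ d)
    (hpos : ∀ i ≤ k, 0 < (kraw m i).eval ((d : ℝ) - 1))
    (hneg : (kraw m (k + 1)).eval ((d : ℝ) - 1) < 0) :
    (kraw (m + 1) (k + 1)).eval (d : ℝ) ≠ 0 ∧
      ∃ (f : ℝ[X]) (c : ℕ → ℝ), LPConditions (m + 1) d f c ∧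
        f.eval 0 / c 0 = levenshtein (k + 1) (m + 1) (d : ℝ) := by
  set α := (kraw m k).eval ((d : ℝ) - 1) with hα
  set β := -(kraw m (k + 1)).eval ((d : ℝ) - 1) with hβ
  have hαpos : 0 < α := hpos k le_rfl
  have hβpos : 0 < β := neg_pos.mpr hneg
  set a : ℕ → ℝ := fun i =>
    4 * (m.choose k * 3 ^ k / (m.choose i * 3 ^ i)) * (kraw m i).eval ((d : ℝ) - 1) with ha
  have ha_pos : ∀ i ∈ Finset.range (k + 1), 0 < a i := by
    intro i hi
    have hi' : i ≤ k := Nat.lt_succ_iff.mp (Finset.mem_range.mp hi)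
    have h1 := hpos i hi'
    have h3 := Nat.choose_pos (by omega : i ≤ m)
    have h4 := Nat.choose_pos (by omega : k ≤ m)
    positivity
  set T : ℝ[X] := ∑ i ∈ Finset.range (k + 1), C (a i) * (kraw m i).comp (X - C 1) with hT
  have hTe : ∀ x : ℝ, T.eval x = ∑ i ∈ Finset.range (k + 1), a i * (kraw m i).eval (x - 1) := by
    intro x
    simp [hT, eval_finsetSum, eval_comp]
  set F : ℝ → ℝ := fun x => ((k : ℝ) + 1) *
    (α * (kraw m (k + 1)).eval (x - 1) + β * (kraw m k).eval (x - 1)) with hF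
  have hFT : ∀ x : ℝ, F x = (d - x) * T.eval x := by
    intro x
    have h := christoffel_darboux hk (x - 1) ((d : ℝ) - 1)
    rw [hTe]
    simp only [hF, ha, hα, hβ]
    linear_combination h
  have hT0 : 0 < T.eval 0 := by
    rw [hTe]
    exact Finset.sum_pos (fun i hi => mul_pos (ha_pos i hi)
      (kraw_eval_pos_of_nonpos (by have := Finset.mem_range.mp hi; omega) (by norm_num))) (by simp)
  have hTdeg : T.natDegree ≤ k := by
    refine natDegree_sum_le_of_forall_le _ _ fun i hi => (natDegree_C_mul_le _ _).trans
      (natDegree_comp_le.trans ?_)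
    rw [natDegree_X_sub_C, mul_one]
    exact (natDegree_kraw_le _ _).trans (Nat.lt_succ_iff.mp (Finset.mem_range.mp hi))
  have hTX : T.divX = 0 ∨ T.divX.natDegree < k := by
    rcases Nat.eq_zero_or_pos T.natDegree with h | h
    · left
      rw [eq_C_of_natDegree_eq_zero h, divX_C]
    · right
      rw [natDegree_divX_eq_natDegree_tsub_one]
      omega
  have hTsplit : ∀ x : ℝ, T.eval x = T.eval 0 + x * T.divX.eval x := by
    intro x
    conv_lhs => rw [← divX_mul_X_add T]
    simp [coeff_zero_eq_eval_zero]
    ring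
  set g : ℕ → ℝ := fun x => F x * T.eval (x : ℝ) with hg
  have hgnonneg : KrawNonneg (m + 1) g := by
    refine KrawNonneg.mul ?_ ?_
    · exact (((krawNonneg_kraw_pred hk).const_mul hαpos.le).add
        ((krawNonneg_kraw_pred (by omega)).const_mul hβpos.le)).const_mul (by positivity)
    · simp only [hTe]
      exact KrawNonneg.sum _ fun i hi => (krawNonneg_kraw_pred
        (by have := Finset.mem_range.mp hi; omega)).const_mul (ha_pos i hi).le
  -- Writing `T = T(0) + x T₁`, the part `x T₁` is orthogonal to `F`.
  have hc0 : krawCoeff (m + 1) g 0 = T.eval 0 * (((k : ℝ) + 1) * (α + β)) := by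
    have e : ∀ x ∈ Finset.range (m + 1 + 1), ((m + 1).choose x * 3 ^ x : ℝ) * g x =
        ((k : ℝ) + 1) * T.eval 0 * α *
            (((m + 1).choose x * 3 ^ x : ℝ) * (kraw m (k + 1)).eval ((x : ℝ) - 1))
          + ((k : ℝ) + 1) * T.eval 0 * β *
            (((m + 1).choose x * 3 ^ x : ℝ) * (kraw m k).eval ((x : ℝ) - 1))
          + ((k : ℝ) + 1) * α * (((m + 1).choose x * 3 ^ x : ℝ) *
            ((x : ℝ) * T.divX.eval (x : ℝ) * (kraw m (k + 1)).eval ((x : ℝ) - 1)))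
          + ((k : ℝ) + 1) * β * (((m + 1).choose x * 3 ^ x : ℝ) *
            ((x : ℝ) * T.divX.eval (x : ℝ) * (kraw m k).eval ((x : ℝ) - 1))) := by
      intro x _
      simp only [hg, hF]
      rw [hTsplit x]
      ring
    rw [krawCoeff_zero, Finset.sum_congr rfl e, Finset.sum_add_distrib, Finset.sum_add_distrib,
      Finset.sum_add_distrib, ← Finset.mul_sum, ← Finset.mul_sum, ← Finset.mul_sum,
      ← Finset.mul_sum, sum_weight_mul_kraw_pred hk, sum_weight_mul_kraw_pred (by omega),
      sum_weight_mul_self_mul_kraw_pred (hTX.imp_right Nat.lt_succ_of_lt),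
      sum_weight_mul_self_mul_kraw_pred hTX]
    field_simp
    ring
  have hc0pos : 0 < krawCoeff (m + 1) g 0 := by
    rw [hc0]
    positivity
  set f : ℝ[X] := ∑ i ∈ Finset.range (m + 1 + 1), C (krawCoeff (m + 1) g i) * kraw (m + 1) i
    with hf
  have hfe : ∀ l : ℕ, l ≤ m + 1 → f.eval (l : ℝ) = g l := by
    intro l hl
    rw [← sum_krawCoeff_mul_kraw g hl]
    simp [hf, eval_finsetSum]
  have hf0 : f.eval 0 = F 0 * T.eval 0 := by
    simpa [hg] using hfe 0 (Nat.zero_le _)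
  have hPd : (kraw (m + 1) (k + 1)).eval (d : ℝ) = -(α + β) := by
    have h1 := sum_kraw_eq hk (d : ℝ)
    rw [Finset.sum_range_succ, sum_kraw_eq (by omega)] at h1
    rw [hα, hβ]
    linarith
  have hsum0 : α + β ≠ 0 := by positivity
  refine ⟨by rw [hPd]; exact neg_ne_zero.mpr hsum0, f, krawCoeff (m + 1) g,
    ⟨hf, hc0pos, fun i _ hi => hgnonneg i hi, ?_, fun i hdi hi => ?_⟩, ?_⟩
  · have hd' : (0 : ℝ) < d := by exact_mod_cast hd
    rw [hf0, hFT, sub_zero]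
    positivity
  · have hdi' : (d : ℝ) ≤ i := by exact_mod_cast hdi
    rw [hfe i hi]
    simp only [hg]
    rw [hFT, mul_assoc]
    exact mul_nonpos_of_nonpos_of_nonneg (by linarith) (mul_self_nonneg _)
  · have hV : ∀ j, ballSize (m + 1) j = ∑ i ∈ Finset.range (j + 1),
        ((m + 1).choose i : ℝ) * 3 ^ i := fun j => Finset.sum_congr rfl fun i _ => mul_comm _ _
    have hV1 := kraw_pred_eval_neg_one (n := m + 1) (e := k + 1) (by omega)
    have hV0 := kraw_pred_eval_neg_one (n := m + 1) (e := k) (by omega)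
    rw [Nat.add_sub_cancel] at hV1 hV0
    rw [hf0, hc0, levenshtein, hPd, Nat.add_sub_cancel, Nat.add_sub_cancel, ← hα, hF]
    simp only [hV1, hV0, hV, Finset.sum_range_succ _ (k + 1)]
    have hk1 : (k : ℝ) + 1 ≠ 0 := by positivity
    have := hT0.ne'
    field_simp
    ring

/-- Multiplication by `n + 1 - x` turns an admissible polynomial for length `n` into one for length
`n + 1`, and multiplies the bound by `4`. -/
lemma LPConditions.succ_length {n d : ℕ} {g : ℝ[X]} {c : ℕ → ℝ} (h : LPConditions n d g c) :
    ∃ (f : ℝ[X]) (b : ℕ → ℝ), LPConditions (n + 1) d f b ∧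
      f.eval 0 / b 0 = 4 * (g.eval 0 / c 0) := by
  have hn : (0 : ℝ) < (n : ℝ) + 1 := by positivity
  have hev : ∀ x : ℝ, ((C ((n : ℝ) + 1) - X) * g).eval x = ((n : ℝ) + 1 - x) * g.eval x := by
    intro x
    simp
  have hb0 : (((n : ℝ) + 1 - (0 : ℕ)) * c 0 + (0 : ℕ) * c (0 - 1)) / 4 =
      ((n : ℝ) + 1) * c 0 / 4 := by
    simp
  refine ⟨(C ((n : ℝ) + 1) - X) * g,
    fun i => (((n : ℝ) + 1 - i) * c i + i * c (i - 1)) / 4, ⟨?_, ?_, ?_, ?_, ?_⟩, ?_⟩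
  · have h4 : (C 4 : ℝ[X]) ≠ 0 := C_ne_zero.mpr (by norm_num)
    refine mul_left_cancel₀ h4 ?_
    have e1 : C 4 * ((C ((n : ℝ) + 1) - X) * g) = ∑ i ∈ Finset.range (n + 1),
        (C (((n : ℝ) + 1 - i) * c i) * kraw (n + 1) i
          + C (((i : ℝ) + 1) * c i) * kraw (n + 1) (i + 1)) := by
      rw [h.expansion, Finset.mul_sum, Finset.mul_sum]
      refine Finset.sum_congr rfl fun i hi => ?_
      rw [C_mul, C_mul]
      linear_combination C (c i) *
        length_sub_mul_kraw (Nat.lt_succ_iff.mp (Finset.mem_range.mp hi))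
    have e2 : C 4 * ∑ i ∈ Finset.range (n + 1 + 1),
          C ((((n : ℝ) + 1 - i) * c i + i * c (i - 1)) / 4) * kraw (n + 1) i =
        ∑ i ∈ Finset.range (n + 1 + 1), C (((n : ℝ) + 1 - i) * c i) * kraw (n + 1) i
          + ∑ i ∈ Finset.range (n + 1 + 1), C ((i : ℝ) * c (i - 1)) * kraw (n + 1) i := by
      rw [Finset.mul_sum, ← Finset.sum_add_distrib]
      refine Finset.sum_congr rfl fun i _ => ?_
      rw [← mul_assoc, ← C_mul, mul_div_cancel₀ _ (by norm_num), C_add, add_mul]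
    rw [e1, e2, Finset.sum_add_distrib, Finset.sum_range_succ _ (n + 1),
      Finset.sum_range_succ' (fun i : ℕ => C ((i : ℝ) * c (i - 1)) * kraw (n + 1) i) (n + 1)]
    simp
  · simp only [hb0]
    have := h.coeff_zero_pos
    positivity
  · intro i h1 hi
    have hi' : (i : ℝ) ≤ n + 1 := by exact_mod_cast hi
    have hc : ∀ j ≤ n, 0 ≤ c j := by
      intro j hj
      rcases Nat.eq_zero_or_pos j with rfl | hj0
      · exact h.coeff_zero_pos.le
      · exact h.coeff_nonneg j hj0 hj
    have h2 := mul_nonneg i.cast_nonneg (hc (i - 1) (by omega))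
    have h3 : 0 ≤ ((n : ℝ) + 1 - i) * c i := by
      rcases Nat.lt_or_ge n i with hlt | hge
      · obtain rfl : i = n + 1 := by omega
        simp
      · exact mul_nonneg (by linarith) (hc i hge)
    positivity
  · rw [hev, sub_zero]
    exact mul_pos hn h.eval_zero_pos
  · intro i hdi hi
    rw [hev]
    rcases Nat.lt_or_ge n i with hlt | hge
    · obtain rfl : i = n + 1 := by omega
      simp
    · have hi' : (i : ℝ) ≤ n := by exact_mod_cast hge
      exact mul_nonpos_of_nonneg_of_nonpos (by linarith) (h.eval_nonpos i hdi hge)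
  · simp only [hb0]
    rw [hev, sub_zero]
    have := h.coeff_zero_pos.ne'
    field_simp

/-! ### Weight enumerators of quantum codes -/

/-- The matrix of `errorOp a`. -/
noncomputable def errorMat {n : ℕ} (a : Fin n → Fin 4) :
    Matrix (Fin n → Fin 2) (Fin n → Fin 2) ℂ :=
  Matrix.of fun x y => ∏ k, pauli (a k) (x k) (y k)

lemma pauli_isHermitian (s : Fin 4) : (pauli s).IsHermitian := by
  ext i j
  fin_cases s <;> fin_cases i <;> fin_cases j <;> simp [pauli]

lemma errorMat_isHermitian {n : ℕ} (a : Fin n → Fin 4) : (errorMat a).IsHermitian := by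
  ext x y
  rw [Matrix.conjTranspose_apply, errorMat, Matrix.of_apply, Matrix.of_apply, star_prod]
  exact Finset.prod_congr rfl fun k _ => (pauli_isHermitian (a k)).apply _ _

/-- The Pauli completeness relation `∑_s (σ_t σ_s σ_t) ⊗ σ_s = 2 (σ_t ⊗ σ_t) SWAP`, in coordinates,
tensored over the qubits. -/
lemma sum_errorSign_mul_errorMat {n : ℕ} (b : Fin n → Fin 4) (x y z w : Fin n → Fin 2) :
    ∑ a, (errorSign a b : ℂ) * (errorMat a x y * errorMat a z w) =
      2 ^ n * (errorMat b x w * errorMat b z y) := by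
  have h : ∀ (t : Fin 4) (i j k l : Fin 2),
      ∑ s, (pauliSign s t : ℂ) * (pauli s i j * pauli s k l) =
        2 * (pauli t i l * pauli t k j) := by
    intro t i j k l
    fin_cases t <;> fin_cases i <;> fin_cases j <;> fin_cases k <;> fin_cases l <;>
      simp [Fin.sum_univ_four, pauliSign, pauli] <;> norm_num
  simp only [errorMat, errorSign, Matrix.of_apply, Complex.ofReal_prod, ← Finset.prod_mul_distrib]
  rw [← Fintype.prod_sum (fun k s =>
    (pauliSign s (b k) : ℂ) * (pauli s (x k) (y k) * pauli s (z k) (w k)))]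
  simp only [h]
  rw [Finset.prod_mul_distrib]
  simp

/-- The duality behind the MacWilliams identity, for one error operator. -/
lemma sum_errorSign_mul_trace_sq {n : ℕ} (A : Matrix (Fin n → Fin 2) (Fin n → Fin 2) ℂ)
    (b : Fin n → Fin 4) :
    ∑ a, (errorSign a b : ℂ) * ((errorMat a * A).trace * (errorMat a * A).trace) =
      2 ^ n * (errorMat b * A * errorMat b * A).trace := by
  have h1 : ∀ a : Fin n → Fin 4, (errorMat a * A).trace = ∑ x, ∑ y, errorMat a x y * A y x :=
    fun a => rfl
  have h2 : ∀ a : Fin n → Fin 4,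
      (errorSign a b : ℂ) * ((errorMat a * A).trace * (errorMat a * A).trace) =
      ∑ x, ∑ y, ∑ z, ∑ w, A y x * A w z *
        ((errorSign a b : ℂ) * (errorMat a x y * errorMat a z w)) := by
    intro a
    rw [h1]
    simp only [Finset.sum_mul, Finset.mul_sum]
    exact Finset.sum_congr rfl fun x _ => Finset.sum_congr rfl fun y _ =>
      Finset.sum_congr rfl fun z _ => Finset.sum_congr rfl fun w _ => by ring
  have h3 : (errorMat b * A * errorMat b * A).trace =
      ∑ x, ∑ y, ∑ z, ∑ w, A y x * A w z * (errorMat b x w * errorMat b z y) := by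
    simp only [Matrix.trace, Matrix.diag, Matrix.mul_apply, Finset.sum_mul]
    exact Finset.sum_congr rfl fun x _ => Finset.sum_congr rfl fun y _ =>
      Finset.sum_congr rfl fun z _ => Finset.sum_congr rfl fun w _ => by ring
  rw [Finset.sum_congr rfl fun a _ => h2 a, h3]
  rw [Finset.sum_comm, Finset.mul_sum]
  refine Finset.sum_congr rfl fun x _ => ?_
  rw [Finset.sum_comm, Finset.mul_sum]
  refine Finset.sum_congr rfl fun y _ => ?_
  rw [Finset.sum_comm, Finset.mul_sum]
  refine Finset.sum_congr rfl fun z _ => ?_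
  rw [Finset.sum_comm, Finset.mul_sum]
  refine Finset.sum_congr rfl fun w _ => ?_
  rw [← Finset.mul_sum, sum_errorSign_mul_errorMat]
  ring

/-- The matrix of the projection onto a code. -/
noncomputable def projMat {n : ℕ} (Q : Submodule ℂ (Qubits n)) :
    Matrix (Fin n → Fin 2) (Fin n → Fin 2) ℂ :=
  Matrix.toEuclideanLin.symm (proj Q)

lemma proj_eq_toEuclideanLin {n : ℕ} (Q : Submodule ℂ (Qubits n)) :
    proj Q = Matrix.toEuclideanLin (projMat Q) :=
  (LinearEquiv.apply_symm_apply _ _).symm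

lemma toEuclideanLin_mul {n : ℕ} (A B : Matrix (Fin n → Fin 2) (Fin n → Fin 2) ℂ) :
    (Matrix.toEuclideanLin (A * B) : Module.End ℂ (Qubits n)) =
      Matrix.toEuclideanLin A * Matrix.toEuclideanLin B := by
  ext1 v
  simp [Matrix.toLpLin_apply]

lemma trace_toEuclideanLin {n : ℕ} (A : Matrix (Fin n → Fin 2) (Fin n → Fin 2) ℂ) :
    LinearMap.trace ℂ (Qubits n) (Matrix.toEuclideanLin A) = A.trace := by
  change LinearMap.trace ℂ (Qubits n) (Matrix.toLpLin 2 2 A) = _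
  rw [Matrix.toLpLin_eq_toLin, Matrix.trace_toLin_eq]

lemma projMat_isHermitian {n : ℕ} (Q : Submodule ℂ (Qubits n)) : (projMat Q).IsHermitian := by
  rw [← Matrix.isSymmetric_toEuclideanLin_iff, ← proj_eq_toEuclideanLin]
  exact Q.starProjection_isSymmetric

lemma projMat_mul_self {n : ℕ} (Q : Submodule ℂ (Qubits n)) :
    projMat Q * projMat Q = projMat Q := by
  refine Matrix.toEuclideanLin.injective ?_
  have h := toEuclideanLin_mul (projMat Q) (projMat Q)
  rw [← proj_eq_toEuclideanLin] at h
  rw [← proj_eq_toEuclideanLin]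
  refine h.trans ?_
  have := Q.isIdempotentElem_starProjection
  ext1 v
  exact congrArg (fun T : Qubits n →L[ℂ] Qubits n => T v) this

lemma trace_projMat {n : ℕ} (Q : Submodule ℂ (Qubits n)) :
    (projMat Q).trace = Module.finrank ℂ Q := by
  rw [← trace_toEuclideanLin, ← proj_eq_toEuclideanLin]
  refine LinearMap.IsProj.trace (p := Q) ⟨fun x => ?_, fun x hx => ?_⟩
  · exact Q.starProjection_apply_mem x
  · exact Submodule.starProjection_eq_self_iff.mpr hx

lemma trace_errorOp_mul_proj {n : ℕ} (Q : Submodule ℂ (Qubits n)) (a : Fin n → Fin 4) :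
    LinearMap.trace ℂ (Qubits n) (errorOp a * proj Q) = (errorMat a * projMat Q).trace := by
  rw [proj_eq_toEuclideanLin, ← trace_toEuclideanLin, toEuclideanLin_mul]
  rfl

lemma trace_errorOp_mul_proj_mul {n : ℕ} (Q : Submodule ℂ (Qubits n)) (a : Fin n → Fin 4) :
    LinearMap.trace ℂ (Qubits n) (errorOp a * proj Q * errorOp a * proj Q) =
      (errorMat a * projMat Q * errorMat a * projMat Q).trace := by
  rw [proj_eq_toEuclideanLin, ← trace_toEuclideanLin, toEuclideanLin_mul, toEuclideanLin_mul,
    toEuclideanLin_mul]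
  rfl

/-- `Tr(EP)² ≥ 0`, since `E` and `P` are Hermitian. -/
lemma trace_mul_trace_nonneg {n : ℕ} (Q : Submodule ℂ (Qubits n)) (a : Fin n → Fin 4) :
    0 ≤ (errorMat a * projMat Q).trace * (errorMat a * projMat Q).trace := by
  have h : star (errorMat a * projMat Q).trace = (errorMat a * projMat Q).trace := by
    rw [← Matrix.trace_conjTranspose, Matrix.conjTranspose_mul, (errorMat_isHermitian a).eq,
      (projMat_isHermitian Q).eq, Matrix.trace_mul_comm]
  nth_rewrite 1 [← h]
  exact star_mul_self_nonneg _

lemma trace_eq_trace_sq {n : ℕ} (Q : Submodule ℂ (Qubits n)) (a : Fin n → Fin 4) :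
    (errorMat a * projMat Q * errorMat a * projMat Q).trace =
      ((projMat Q * errorMat a * projMat Q) * (projMat Q * errorMat a * projMat Q)).trace := by
  have hP := projMat_mul_self Q
  have h1 : (projMat Q * errorMat a * projMat Q) * (projMat Q * errorMat a * projMat Q) =
      projMat Q * errorMat a * (projMat Q * projMat Q) * errorMat a * projMat Q := by
    simp only [mul_assoc]
  have h2 : projMat Q * (projMat Q * errorMat a * projMat Q * errorMat a) =
      (projMat Q * projMat Q) * errorMat a * projMat Q * errorMat a := by
    simp only [mul_assoc]
  rw [h1, hP, Matrix.trace_mul_comm (projMat Q * errorMat a * projMat Q * errorMat a), h2, hP,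
    Matrix.trace_mul_comm (errorMat a * projMat Q * errorMat a)]
  simp only [mul_assoc]

/-- `Tr(EPEP)` is the squared Hilbert–Schmidt norm of the Hermitian operator `PEP`. -/
lemma trace_errorMat_mul_projMat_mul_nonneg {n : ℕ} (Q : Submodule ℂ (Qubits n))
    (a : Fin n → Fin 4) : 0 ≤ (errorMat a * projMat Q * errorMat a * projMat Q).trace := by
  have h : (projMat Q * errorMat a * projMat Q).conjTranspose =
      projMat Q * errorMat a * projMat Q := by
    rw [Matrix.conjTranspose_mul, Matrix.conjTranspose_mul, (errorMat_isHermitian a).eq,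
      (projMat_isHermitian Q).eq, mul_assoc]
  rw [trace_eq_trace_sq]
  nth_rewrite 1 [← h]
  exact (Matrix.posSemidef_conjTranspose_mul_self _).trace_nonneg

lemma enumA_nonneg {n : ℕ} (Q : Submodule ℂ (Qubits n)) (i : ℕ) : 0 ≤ enumA Q i := by
  refine mul_nonneg (Finset.sum_nonneg fun a _ => ?_) ?_
  · rw [trace_errorOp_mul_proj]
    exact trace_mul_trace_nonneg Q a
  · have h := Complex.zero_le_real.mpr (inv_nonneg.mpr (sq_nonneg (Module.finrank ℂ Q : ℝ)))
    push_cast at h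
    exact h

lemma enumB_nonneg {n : ℕ} (Q : Submodule ℂ (Qubits n)) (i : ℕ) : 0 ≤ enumB Q i := by
  refine mul_nonneg (Finset.sum_nonneg fun a _ => ?_) ?_
  · rw [trace_errorOp_mul_proj_mul]
    exact trace_errorMat_mul_projMat_mul_nonneg Q a
  · have h := Complex.zero_le_real.mpr (inv_nonneg.mpr (Nat.cast_nonneg (Module.finrank ℂ Q)))
    push_cast at h
    exact h

lemma errorMat_zero {n : ℕ} : errorMat (0 : Fin n → Fin 4) = 1 := by
  ext x y
  by_cases h : x = y
  · subst h
    simp [errorMat, pauli]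
  · obtain ⟨k, hk⟩ := Function.ne_iff.mp h
    rw [Matrix.one_apply_ne h, errorMat, Matrix.of_apply]
    exact Finset.prod_eq_zero (Finset.mem_univ k) (by simp [pauli, Matrix.one_apply_ne hk])

lemma filter_hammingNorm_eq_zero {n : ℕ} :
    ((Finset.univ : Finset (Fin n → Fin 4)).filter fun a => hammingNorm a = 0) = {0} := by
  ext a
  simp [hammingNorm_eq_zero]

lemma enumA_zero {n K d : ℕ} {Q : Submodule ℂ (Qubits n)} (h : IsQuantumCode n K d Q) :
    enumA Q 0 = 1 := by
  have hK : (K : ℂ) ≠ 0 := by exact_mod_cast h.pos.ne'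
  rw [enumA, filter_hammingNorm_eq_zero, Finset.sum_singleton, trace_errorOp_mul_proj,
    errorMat_zero, one_mul, trace_projMat, h.finrank_eq]
  field_simp

lemma enumB_zero {n K d : ℕ} {Q : Submodule ℂ (Qubits n)} (h : IsQuantumCode n K d Q) :
    enumB Q 0 = 1 := by
  have hK : (K : ℂ) ≠ 0 := by exact_mod_cast h.pos.ne'
  rw [enumB, filter_hammingNorm_eq_zero, Finset.sum_singleton, trace_errorOp_mul_proj_mul,
    errorMat_zero, one_mul, mul_one, projMat_mul_self, trace_projMat, h.finrank_eq]
  field_simp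

/-- If `PEP = cP` for every `E` of weight `i`, both enumerators equal the sum of the `c²`. -/
lemma enumA_eq_enumB {n K d : ℕ} {Q : Submodule ℂ (Qubits n)} (h : IsQuantumCode n K d Q) {i : ℕ}
    (hi : i < d) : enumA Q i = enumB Q i := by
  have hK : (K : ℂ) ≠ 0 := by exact_mod_cast h.pos.ne'
  rw [enumA, enumB, Finset.sum_div, Finset.sum_div, h.finrank_eq]
  refine Finset.sum_congr rfl fun a ha => ?_
  obtain ⟨c, hc⟩ := h.detects a (by rw [(Finset.mem_filter.mp ha).2]; exact hi)
  have hc' : projMat Q * errorMat a * projMat Q = c • projMat Q := by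
    refine Matrix.toEuclideanLin.injective ?_
    rw [map_smul, ← proj_eq_toEuclideanLin, ← hc]
    refine (toEuclideanLin_mul _ _).trans ?_
    rw [toEuclideanLin_mul, ← proj_eq_toEuclideanLin]
    rfl
  have htr := trace_projMat Q
  rw [h.finrank_eq] at htr
  have h1 : (errorMat a * projMat Q).trace = c * K := by
    have : (projMat Q * errorMat a * projMat Q).trace = (errorMat a * projMat Q).trace := by
      rw [Matrix.trace_mul_comm, ← mul_assoc, projMat_mul_self, Matrix.trace_mul_comm]
    rw [← this, hc', Matrix.trace_smul, htr, smul_eq_mul]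
  have h2 : (errorMat a * projMat Q * errorMat a * projMat Q).trace = c * (c * K) := by
    rw [trace_eq_trace_sq, hc', Matrix.smul_mul, Matrix.mul_smul, projMat_mul_self,
      Matrix.trace_smul, Matrix.trace_smul, htr, smul_eq_mul, smul_eq_mul]
  rw [trace_errorOp_mul_proj, trace_errorOp_mul_proj_mul, h1, h2]
  field_simp

/-- The quantum MacWilliams identity. -/
lemma sum_kraw_mul_enumB {n K d : ℕ} {Q : Submodule ℂ (Qubits n)} (h : IsQuantumCode n K d Q)
    (j : ℕ) :
    ∑ i ∈ Finset.range (n + 1), (((kraw n j).eval (i : ℝ) : ℝ) : ℂ) * enumB Q i =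
      2 ^ n * K * enumA Q j := by
  have hK : (K : ℂ) ≠ 0 := by exact_mod_cast h.pos.ne'
  have h2 : (2 : ℂ) ^ n ≠ 0 := pow_ne_zero _ two_ne_zero
  set t : (Fin n → Fin 4) → ℂ := fun a =>
    (errorMat a * projMat Q).trace * (errorMat a * projMat Q).trace with ht
  set s : (Fin n → Fin 4) → ℂ := fun a =>
    (errorMat a * projMat Q * errorMat a * projMat Q).trace with hs
  have hA : enumA Q j = (∑ a : Fin n → Fin 4 with hammingNorm a = j, t a) / (K : ℂ) ^ 2 := by
    rw [enumA, h.finrank_eq]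
    simp only [trace_errorOp_mul_proj, ht]
  have hB : ∀ i, enumB Q i = (∑ a : Fin n → Fin 4 with hammingNorm a = i, s a) / (K : ℂ) := by
    intro i
    rw [enumB, h.finrank_eq]
    simp only [trace_errorOp_mul_proj_mul, hs]
  have h3 : ∑ i ∈ Finset.range (n + 1), (((kraw n j).eval (i : ℝ) : ℝ) : ℂ) * enumB Q i =
      (∑ b : Fin n → Fin 4, (((kraw n j).eval (hammingNorm b : ℝ) : ℝ) : ℂ) * s b) / K := by
    rw [sum_eq_sum_weight, Finset.sum_div]
    refine Finset.sum_congr rfl fun i _ => ?_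
    rw [hB, mul_div_assoc', Finset.mul_sum]
    congr 1
    exact Finset.sum_congr rfl fun a ha => by rw [(Finset.mem_filter.mp ha).2]
  have h4 : 2 ^ n * ∑ b : Fin n → Fin 4, (((kraw n j).eval (hammingNorm b : ℝ) : ℝ) : ℂ) * s b =
      ∑ a, t a * ∑ b : Fin n → Fin 4 with hammingNorm b = j, if b = a then (4 : ℂ) ^ n else 0 := by
    have e1 : ∀ b : Fin n → Fin 4,
        2 ^ n * ((((kraw n j).eval (hammingNorm b : ℝ) : ℝ) : ℂ) * s b) =
        ∑ a, t a * (((kraw n j).eval (hammingNorm b : ℝ) * errorSign b a : ℝ) : ℂ) := by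
      intro b
      rw [mul_left_comm, hs, ← sum_errorSign_mul_trace_sq, Finset.mul_sum]
      refine Finset.sum_congr rfl fun a _ => ?_
      rw [errorSign_comm b a]
      push_cast
      ring
    rw [Finset.mul_sum, Finset.sum_congr rfl fun b _ => e1 b, Finset.sum_comm]
    refine Finset.sum_congr rfl fun a _ => ?_
    rw [← Finset.mul_sum, ← Complex.ofReal_sum]
    congr 1
    have e2 := kraw_orthogonality (i := j) (hammingNorm_le a)
    rw [← sum_weight_fun_mul_errorSign (fun x => (kraw n j).eval (x : ℝ)) a] at e2
    rw [e2, Finset.sum_ite_eq']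
    simp only [Finset.mem_filter, Finset.mem_univ, true_and, eq_comm (a := j)]
    split_ifs <;> simp
  have h5 : ∑ a, t a * ∑ b : Fin n → Fin 4 with hammingNorm b = j,
        (if b = a then (4 : ℂ) ^ n else 0) =
      4 ^ n * ∑ a : Fin n → Fin 4 with hammingNorm a = j, t a := by
    simp only [Finset.sum_ite_eq', Finset.mem_filter, Finset.mem_univ, true_and]
    rw [Finset.mul_sum, Finset.sum_filter]
    refine Finset.sum_congr rfl fun a _ => ?_
    split_ifs <;> ring
  have h6 : (4 : ℂ) ^ n = 2 ^ n * 2 ^ n := by rw [← mul_pow]; norm_num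
  rw [h5, h6, mul_assoc] at h4
  rw [h3, mul_left_cancel₀ h2 h4, hA]
  field_simp

/-! ### The linear programming bound -/

/-- For every Krawtchouk expansion `f = ∑ c_j P_j`, the MacWilliams identity gives
`∑ f(i) B_i = 2^n K ∑ c_j A_j`. -/
lemma sum_eval_mul_enumB {n K d : ℕ} {Q : Submodule ℂ (Qubits n)} (h : IsQuantumCode n K d Q)
    {f : ℝ[X]} {c : ℕ → ℝ} (hf : f = ∑ i ∈ Finset.range (n + 1), C (c i) * kraw n i) :
    ∑ i ∈ Finset.range (n + 1), ((f.eval (i : ℝ) : ℝ) : ℂ) * enumB Q i =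
      2 ^ n * K * ∑ j ∈ Finset.range (n + 1), (c j : ℂ) * enumA Q j := by
  have e : ∀ i : ℕ, ((f.eval (i : ℝ) : ℝ) : ℂ) * enumB Q i =
      ∑ j ∈ Finset.range (n + 1),
        (c j : ℂ) * ((((kraw n j).eval (i : ℝ) : ℝ) : ℂ) * enumB Q i) := by
    intro i
    rw [hf, eval_finsetSum, Complex.ofReal_sum, Finset.sum_mul]
    refine Finset.sum_congr rfl fun j _ => ?_
    rw [eval_mul, eval_C, Complex.ofReal_mul, mul_assoc]
  rw [Finset.sum_congr rfl fun i _ => e i, Finset.sum_comm, Finset.mul_sum]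
  refine Finset.sum_congr rfl fun j _ => ?_
  rw [← Finset.mul_sum, sum_kraw_mul_enumB h]
  ring

lemma sum_range_succ_eq_add_sum_Icc {M : Type*} [AddCommMonoid M] (n : ℕ) (g : ℕ → M) :
    ∑ i ∈ Finset.range (n + 1), g i = g 0 + ∑ i ∈ Finset.Icc 1 n, g i := by
  rw [Finset.range_eq_Ico, Finset.sum_eq_sum_Ico_succ_bot (Nat.succ_pos n)]
  rfl

theorem linear_programming_bound {n K d : ℕ} {Q : Submodule ℂ (Qubits n)}
    (h : IsNondegenerateCode n K d Q) {f : ℝ[X]} {c : ℕ → ℝ} (hf : LPConditions n d f c) :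
    (2 : ℂ) ^ n * (K : ℂ) =
        (((f.eval 0 : ℝ) : ℂ) +
            ∑ i ∈ Finset.Icc 1 n, ((f.eval (i : ℝ) : ℝ) : ℂ) * enumB Q i) /
          (((c 0 : ℝ) : ℂ) + ∑ i ∈ Finset.Icc 1 n, ((c i : ℝ) : ℂ) * enumA Q i) ∧
      (2 : ℝ) ^ n * (K : ℝ) ≤ f.eval 0 / c 0 := by
  have key := sum_eval_mul_enumB h.toIsQuantumCode hf.expansion
  rw [sum_range_succ_eq_add_sum_Icc, sum_range_succ_eq_add_sum_Icc,
    enumA_zero h.toIsQuantumCode, enumB_zero h.toIsQuantumCode, Nat.cast_zero, mul_one,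
    mul_one] at key
  have hA : 0 ≤ ∑ i ∈ Finset.Icc 1 n, ((c i : ℝ) : ℂ) * enumA Q i := by
    refine Finset.sum_nonneg fun i hi => mul_nonneg ?_ (enumA_nonneg Q i)
    obtain ⟨h1, h2⟩ := Finset.mem_Icc.mp hi
    exact_mod_cast hf.coeff_nonneg i h1 h2
  -- For `1 ≤ i < d` the term vanishes because `B_i = A_i = 0`.
  have hB : ∑ i ∈ Finset.Icc 1 n, ((f.eval (i : ℝ) : ℝ) : ℂ) * enumB Q i ≤ 0 := by
    refine Finset.sum_nonpos fun i hi => ?_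
    obtain ⟨h1, h2⟩ := Finset.mem_Icc.mp hi
    rcases Nat.lt_or_ge i d with hid | hid
    · rw [← enumA_eq_enumB h.toIsQuantumCode hid, h.enumA_eq_zero i h1 hid, mul_zero]
    · refine mul_nonpos_of_nonpos_of_nonneg ?_ (enumB_nonneg Q i)
      exact_mod_cast hf.eval_nonpos i hid h2
  obtain ⟨α, hα⟩ : ∃ α : ℝ, ∑ i ∈ Finset.Icc 1 n, ((c i : ℝ) : ℂ) * enumA Q i = α :=
    ⟨_, (Complex.eq_re_of_ofReal_le (r := 0) (by simpa using hA))⟩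
  obtain ⟨β, hβ⟩ : ∃ β : ℝ, ∑ i ∈ Finset.Icc 1 n, ((f.eval (i : ℝ) : ℝ) : ℂ) * enumB Q i = β := by
    refine ⟨-(-∑ i ∈ Finset.Icc 1 n, ((f.eval (i : ℝ) : ℝ) : ℂ) * enumB Q i).re, ?_⟩
    rw [Complex.ofReal_neg, ← Complex.eq_re_of_ofReal_le (r := 0) (by simpa using hB), neg_neg]
  rw [hα] at hA key ⊢
  rw [hβ] at hB key ⊢
  have hα0 : 0 ≤ α := by exact_mod_cast hA
  have hβ0 : β ≤ 0 := by exact_mod_cast hB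
  have hc := hf.coeff_zero_pos
  have hden : 0 < c 0 + α := by linarith
  have keyR : f.eval 0 + β = 2 ^ n * K * (c 0 + α) := by exact_mod_cast key
  constructor
  · rw [key, mul_div_cancel_right₀]
    exact_mod_cast hden.ne'
  · rw [le_div_iff₀ hc]
    have : 0 ≤ (2 : ℝ) ^ n * K * α := by positivity
    linarith

/-- The dimension bound provided by an admissible polynomial. -/
lemma dim_le_of_lpConditions {n K d : ℕ} {Q : Submodule ℂ (Qubits n)}
    (h : IsNondegenerateCode n K d Q) {f : ℝ[X]} {c : ℕ → ℝ} (hf : LPConditions n d f c) :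
    (K : ℝ) ≤ f.eval 0 / c 0 / 2 ^ n := by
  rw [le_div_iff₀ (by positivity), mul_comm]
  exact (linear_programming_bound h hf).2

end QuantumLP

theorem mainTheorem4 (n d : ℕ) (hd : 1 ≤ d) (hdn : d ≤ n) :
    -- the linear programming bound
    (∀ (K : ℕ) (Q : Submodule ℂ (QuantumLP.Qubits n)), QuantumLP.IsNondegenerateCode n K d Q →
      ∀ (f : Polynomial ℝ) (c : ℕ → ℝ), QuantumLP.LPConditions n d f c →
        (2 : ℂ) ^ n * (K : ℂ) =
          (((f.eval 0 : ℝ) : ℂ) +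
              ∑ i ∈ Finset.Icc 1 n, ((f.eval (i : ℝ) : ℝ) : ℂ) * QuantumLP.enumB Q i) /
            (((c 0 : ℝ) : ℂ) +
              ∑ i ∈ Finset.Icc 1 n, ((c i : ℝ) : ℂ) * QuantumLP.enumA Q i) ∧
        (2 : ℝ) ^ n * (K : ℝ) ≤ f.eval 0 / c 0) ∧
    -- the quantum Singleton bound
    (QuantumLP.LPConditions n d (QuantumLP.singletonPoly n d)
        (fun i => ((n - i).choose (d - 1) : ℝ) / (n.choose (d - 1) : ℝ)) ∧
      ∀ (K : ℕ) (Q : Submodule ℂ (QuantumLP.Qubits n)), QuantumLP.IsNondegenerateCode n K d Q →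
        (K : ℝ) ≤ (2 : ℝ) ^ ((n : ℤ) - 2 * (d : ℤ) + 2)) ∧
    -- the quantum Hamming bound
    (∀ e : ℕ, d = 2 * e + 1 →
      (QuantumLP.LPConditions n d (QuantumLP.hammingPoly n e) (QuantumLP.hammingCoeff n e) ∧
        (∀ i : ℕ, d ≤ i → i ≤ n → (QuantumLP.hammingPoly n e).eval (i : ℝ) = 0) ∧
        (QuantumLP.hammingPoly n e).eval 0 = 4 ^ n / QuantumLP.ballSize n e) ∧
      ∀ (K : ℕ) (Q : Submodule ℂ (QuantumLP.Qubits n)), QuantumLP.IsNondegenerateCode n K d Q →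
        (K : ℝ) ≤ 2 ^ n / QuantumLP.ballSize n e) ∧
    -- the Levenshtein bound, first range of `d`; for `k = 1` this range has no upper end
    (∀ k : ℕ, 1 ≤ k → k + 1 ≤ n →
      QuantumLP.minRoot k (n - 1) + 1 < (d : ℝ) →
      (k = 1 ∨ (d : ℝ) < QuantumLP.minRoot (k - 1) (n - 2) + 1) →
      (QuantumLP.kraw n k).eval (d : ℝ) ≠ 0 ∧
      (∃ (f : Polynomial ℝ) (c : ℕ → ℝ), QuantumLP.LPConditions n d f c ∧
        f.eval 0 / c 0 = QuantumLP.levenshtein k n (d : ℝ)) ∧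
      ∀ (K : ℕ) (Q : Submodule ℂ (QuantumLP.Qubits n)), QuantumLP.IsNondegenerateCode n K d Q →
        (K : ℝ) ≤ QuantumLP.levenshtein k n (d : ℝ) / 2 ^ n) ∧
    -- the Levenshtein bound, second range of `d`
    (∀ k : ℕ, 1 ≤ k → k + 2 ≤ n →
      QuantumLP.minRoot k (n - 2) + 1 < (d : ℝ) →
      (d : ℝ) < QuantumLP.minRoot k (n - 1) + 1 →
      (QuantumLP.kraw (n - 1) k).eval (d : ℝ) ≠ 0 ∧
      (∃ (f : Polynomial ℝ) (c : ℕ → ℝ), QuantumLP.LPConditions n d f c ∧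
        f.eval 0 / c 0 = 4 * QuantumLP.levenshtein k (n - 1) (d : ℝ)) ∧
      ∀ (K : ℕ) (Q : Submodule ℂ (QuantumLP.Qubits n)), QuantumLP.IsNondegenerateCode n K d Q →
        (K : ℝ) ≤ 4 * QuantumLP.levenshtein k (n - 1) (d : ℝ) / 2 ^ n) := by
  refine ⟨fun K Q hQ f c hf => QuantumLP.linear_programming_bound hQ hf,
    ⟨QuantumLP.lpConditions_singletonPoly hd hdn, fun K Q hQ => ?_⟩, ?_, ?_, ?_⟩
  · refine (QuantumLP.dim_le_of_lpConditions hQ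
      (QuantumLP.lpConditions_singletonPoly hd hdn)).trans_eq ?_
    have hC : (n.choose (d - 1) : ℝ) ≠ 0 := by
      exact_mod_cast (Nat.choose_pos (by omega : d - 1 ≤ n)).ne'
    rw [QuantumLP.singletonPoly_eval_zero, Nat.sub_zero, div_self hC, div_one]
    have h4 : (4 : ℝ) ^ (n - d + 1) = (2 : ℝ) ^ (2 * ((n : ℤ) - d + 1)) := by
      have h : (2 : ℤ) * ((n : ℤ) - d + 1) = ((2 * (n - d + 1) : ℕ) : ℤ) := by omega
      rw [h, zpow_natCast, pow_mul]
      norm_num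
    rw [h4, ← zpow_natCast (2 : ℝ) n, ← zpow_sub₀ two_ne_zero]
    congr 1
    ring
  · rintro e rfl
    refine ⟨⟨QuantumLP.lpConditions_hammingPoly hdn,
      fun i h1 h2 => QuantumLP.hammingPoly_eval_eq_zero h1 h2,
      QuantumLP.hammingPoly_eval_zero (by omega)⟩, fun K Q hQ => ?_⟩
    refine (QuantumLP.dim_le_of_lpConditions hQ
      (QuantumLP.lpConditions_hammingPoly hdn)).trans_eq ?_
    have h4 : (4 : ℝ) ^ n = 2 ^ n * 2 ^ n := by rw [← mul_pow]; norm_num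
    have hV := (QuantumLP.ballSize_pos n e).ne'
    rw [QuantumLP.hammingPoly_eval_zero (by omega), QuantumLP.hammingCoeff_zero (by omega), h4]
    field_simp
  · intro k hk hkn hlow hhigh
    obtain ⟨k, rfl⟩ : ∃ k', k = k' + 1 := ⟨k - 1, by omega⟩
    obtain ⟨m, rfl⟩ : ∃ m, n = m + 1 := ⟨n - 1, by omega⟩
    have hpos := QuantumLP.kraw_eval_pos_of_range_left (m := m) (k := k) (y := (d : ℝ) - 1)
      (by omega) (hhigh.imp (by omega) sub_lt_iff_lt_add.mpr)
    obtain ⟨h0, f, c, hf, hfc⟩ := QuantumLP.exists_lpConditions_levenshtein (by omega) hd hpos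
      (QuantumLP.kraw_succ_eval_neg (by omega) (lt_sub_iff_add_lt.mpr hlow) hpos)
    refine ⟨h0, ⟨f, c, hf, hfc⟩, fun K Q hQ => ?_⟩
    rw [← hfc]
    exact QuantumLP.dim_le_of_lpConditions hQ hf
  · intro k hk hkn hlow hhigh
    obtain ⟨k, rfl⟩ : ∃ k', k = k' + 1 := ⟨k - 1, by omega⟩
    obtain ⟨m, rfl⟩ : ∃ m, n = m + 1 + 1 := ⟨n - 2, by omega⟩
    have hpos := QuantumLP.kraw_eval_pos_of_range_right (m := m) (k := k) (y := (d : ℝ) - 1)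
      (by omega) (sub_lt_iff_lt_add.mpr hhigh)
    -- Here `d` lies in the range where the kernel polynomial of length `n - 1` is admissible.
    obtain ⟨h0, g, b, hg, hgb⟩ := QuantumLP.exists_lpConditions_levenshtein (by omega) hd hpos
      (QuantumLP.kraw_succ_eval_neg (by omega) (lt_sub_iff_add_lt.mpr hlow) hpos)
    obtain ⟨f, c, hf, hfc⟩ := hg.succ_length
    rw [hgb] at hfc
    refine ⟨h0, ⟨f, c, hf, hfc⟩, fun K Q hQ => ?_⟩
    change (K : ℝ) ≤ 4 * QuantumLP.levenshtein (k + 1) (m + 1) (d : ℝ) / 2 ^ (m + 1 + 1)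
    rw [← hfc]
    exact QuantumLP.dim_le_of_lpConditions hQ hf
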